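/- Let $n\ge 1$ and let $\mathbb R^{n+2}$ carry the constant metric $\eta=\mathrm{diag}(1,1,-1,\dots,-1)$ of signature $(2,n)$. Let $f$ be a linear form on $\mathbb R^{n+2}$, let $F=\sharp df$ be its gradient (the constant vector field with $\eta(F,v)=df(v)$ for all $v$), and assume $F^2:=\eta(F,F)=\epsilon H^2$ with $\epsilon\in\{1,-1\}$ and $H>0$. Let $$\Sigma_n=\{y\in\mathbb R^{n+2}:\ \eta(y,y)=0,\ f(y)=1\}$$ be the $n$-dimensional (anti-)de Sitter space cut out of the null cone by the hyperplane $f=1$, with the metric induced by $\eta$ and the inclusion $m:\Sigma_n\to\mathbb R^{n+2}$. Let $D=y^\alpha\partial_\alpha$ be the dilation vector field, $i_X$ the interior product, $\mathcal L_X=i_Xd+di_X$ the Lie derivative, and let $\square=-(d\delta+\delta d)$ be the Laplace–de Rham operator of a pseudo-Riemannian metric $g$, where $\delta=(-1)^p\,{*}^{-1}d\,{*}$ on $p$-forms and $*$ is the Hodge operator, $\beta\wedge{*}\alpha=(\beta,\alpha)_g\,\omega_g$. Write $\square_{n+2}$ and $\square_\Sigma$ for this operator on $(\mathbb R^{n+2},\eta)$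 and on $\Sigma_n$. Then $[F,D]=F$, and for every smooth one-form $a$ on $\mathbb R^{n+2}$, with $a_\Sigma=m^*a$, $$m^*(\square_{n+2}a)=\square_\Sigma a_\Sigma+m^*\Bigl[-\epsilon H^2\bigl(\mathcal L_D^2+(n-3)\mathcal L_D+2\,d\,i_D\bigr)+2\mathcal L_F\mathcal L_D+(n-4)\mathcal L_F+2\,d\,i_F\Bigr](a)$$ $$\phantom{m^*(\square_{n+2}a)}=\square_\Sigma a_\Sigma+m^*\Bigl[-\epsilon H^2\bigl(\mathcal L_D^2+(n-3)\mathcal L_D+2\,d\,i_D\bigr)+2\mathcal L_D\mathcal L_F+(n-2)\mathcal L_F+2\,d\,i_F\Bigr](a).$$ Both are equalities of one-forms on $\Sigma_n$, that is, they hold in every smooth local parametrisation of $\Sigma_n$, and such parametrisations cover $\Sigma_n$. -/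

import Mathlib

open scoped ContDiff

noncomputable section

namespace HodgeDeRham

/-- Alternating `p`-linear forms on `ℝ^d`. -/
abbrev Alt (d p : ℕ) : Type := (Fin d → ℝ) [⋀^Fin p]→L[ℝ] ℝ

/-- Differential `p`-forms on (an open subset of) `ℝ^d`; on an open subset the values
elsewhere play no role, because every operator below only uses germs of forms. -/
abbrev DForm (d p : ℕ) : Type := (Fin d → ℝ) → Alt d p

/-- A pseudo-Riemannian metric on (an open subset of) `ℝ^d`, through its Gram matrix
`g i j = g(∂_i, ∂_j)` in the standard coordinates. -/
abbrev Metric (d : ℕ) : Type := (Fin d → ℝ) → Matrix (Fin d) (Fin d) ℝ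

/-! ### Pointwise operations -/

/-- The alternating form `dx^1 ∧ ⋯ ∧ dx^d`, with its `d` arguments indexed by `Fin k`, `k = d`. -/
def detForm {d k : ℕ} (h : k = d) : Alt d k where
  toMultilinearMap := ((Matrix.detRowAlternating (R := ℝ) (n := Fin d)).domDomCongr
    (finCongr h.symm)).toMultilinearMap
  cont := by
    show Continuous fun v : Fin k → Fin d → ℝ =>
      Matrix.det (Matrix.of fun i j => v (finCongr h.symm i) j)
    exact Continuous.matrix_det (by fun_prop)
  map_eq_zero_of_eq' := ((Matrix.detRowAlternating (R := ℝ) (n := Fin d)).domDomCongr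
    (finCongr h.symm)).map_eq_zero_of_eq'

/-- The volume form `ω = √|det g| dx^1 ∧ ⋯ ∧ dx^d`. -/
def volForm {d k : ℕ} (G : Matrix (Fin d) (Fin d) ℝ) (h : k = d) : Alt d k :=
  Real.sqrt |G.det| • detForm h

/-- The iterated interior product `i_{v_{p-1}} ⋯ i_{v_1} i_{v_0} ω`, that is
`ω(v_0, …, v_{p-1}, ·, …, ·)`. -/
def contract {d q : ℕ} : (p : ℕ) → (Fin p → Fin d → ℝ) → Alt d (q + p) → Alt d q
  | 0, _, β => β
  | p + 1, v, β => contract p (Fin.tail v) (β.curryLeft (v 0))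

/-- The Hodge operator `∗ : Λ^p → Λ^q`, `q + p = d`, of the metric `G`:
`∗α = (1/p!) ∑ α^{a_1 … a_p} ω(∂_{a_1}, …, ∂_{a_p}, ·, …, ·)`, where the indices of `α` are raised
with `G`, i.e. `α^{a_1 … a_p} = α(♯dx^{a_1}, …, ♯dx^{a_p})` and `♯dx^a` is the `a`-th row
of `G⁻¹`. It is characterised by `β ∧ ∗α = (β, α)_G ω`. -/
def hodge {d p q : ℕ} (G : Matrix (Fin d) (Fin d) ℝ) (h : q + p = d) (α : Alt d p) : Alt d q :=
  ((p.factorial : ℝ))⁻¹ • ∑ s : Fin p → Fin d,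
    α (fun i => G⁻¹ (s i)) • contract p (fun i => Pi.single (s i) 1) (volForm G h)

/-- The inverse `∗⁻¹ : Λ^p → Λ^q`, `q + p = d`, of the Hodge operator `∗ : Λ^q → Λ^p`; on `p`-forms
it equals `sgn(det G) (-1)^{p (d + 1)} ∗`. -/
def hodgeInv {d p q : ℕ} (G : Matrix (Fin d) (Fin d) ℝ) (h : q + p = d) (β : Alt d p) : Alt d q :=
  (Real.sign G.det * (-1) ^ (p * (d + 1))) • hodge G h β

/-- The vector `♯α` with `G(♯α, v) = ⟨α, v⟩` for all `v`. -/
def sharp {d : ℕ} (G : Matrix (Fin d) (Fin d) ℝ) (α : (Fin d → ℝ) →L[ℝ] ℝ) : Fin d → ℝ :=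
  G⁻¹.mulVec (fun i => α (Pi.single i 1))

/-! ### Differential operators -/

/-- The codifferential `δ α = ∗⁻¹ d ∗ (-1)^{p+1} α` of a `(p+1)`-form (which is `0` when
`p + 1 > d`, as then `α = 0`). -/
def codiff {d p : ℕ} (g : Metric d) (α : DForm d (p + 1)) : DForm d p :=
  if h : p + 1 ≤ d then
    fun x => ((-1 : ℝ) ^ (p + 1)) •
      hodgeInv (q := p) (p := d - (p + 1) + 1) (g x) (by omega)
        (extDeriv (fun y => hodge (q := d - (p + 1)) (g y) (by omega) (α y)) x)
  else 0

/-- The Laplace–de Rham operator `□ = -(dδ + δd)` on forms of degree `p + 1 ≥ 1`. -/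
def laplaceDeRham {d p : ℕ} (g : Metric d) (α : DForm d (p + 1)) : DForm d (p + 1) :=
  -(extDeriv (codiff g α) + codiff g (extDeriv α))

/-- The interior product `i_X α`. -/
def interiorProd {d p : ℕ} (X : (Fin d → ℝ) → (Fin d → ℝ)) (α : DForm d (p + 1)) : DForm d p :=
  fun x => (α x).curryLeft (X x)

/-- The Lie derivative `L_X = i_X d + d i_X` on forms of degree `p + 1 ≥ 1`. -/
def lieDeriv {d p : ℕ} (X : (Fin d → ℝ) → (Fin d → ℝ)) (α : DForm d (p + 1)) : DForm d (p + 1) :=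
  interiorProd X (extDeriv α) + extDeriv (interiorProd X α)

/-- The pullback `φ^* α`. -/
def pullback {m d p : ℕ} (φ : (Fin m → ℝ) → (Fin d → ℝ)) (α : DForm d p) : DForm m p :=
  fun x => (α (φ x)).compContinuousLinearMap (fderiv ℝ φ x)

/-- The metric `φ^* η` induced by the constant metric `η` of `ℝ^d`. -/
def inducedMetric {m d : ℕ} (η : Matrix (Fin d) (Fin d) ℝ) (φ : (Fin m → ℝ) → (Fin d → ℝ)) :
    Metric m :=
  fun x => Matrix.of fun i j =>
    fderiv ℝ φ x (Pi.single i 1) ⬝ᵥ η.mulVec (fderiv ℝ φ x (Pi.single j 1))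

/-! ### The space `Σ_n` -/

/-- The metric of signature `(2, n)` of `ℝ^{n+2}`. -/
def minkowski (n : ℕ) : Matrix (Fin (n + 2)) (Fin (n + 2)) ℝ :=
  Matrix.diagonal fun i => if i.val < 2 then 1 else -1

/-- The intersection `Σ_n` of the null cone of `ℝ^{n+2}` with the hyperplane `f = 1`. -/
def adsSpace (n : ℕ) (f : (Fin (n + 2) → ℝ) →L[ℝ] ℝ) : Set (Fin (n + 2) → ℝ) :=
  {y | y ⬝ᵥ (minkowski n).mulVec y = 0 ∧ f y = 1}

/-- `φ` is, on the open set `U ⊆ ℝ^m`, a smooth local parametrisation (an immersion) of the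
`m`-dimensional submanifold `S` of `ℝ^d`. -/
structure IsLocalParam {m d : ℕ} (S : Set (Fin d → ℝ)) (U : Set (Fin m → ℝ))
    (φ : (Fin m → ℝ) → (Fin d → ℝ)) : Prop where
  isOpen : IsOpen U
  smooth : ContDiffOn ℝ ∞ φ U
  mapsTo : Set.MapsTo φ U S
  immersion : ∀ x ∈ U, Function.Injective (fderiv ℝ φ x)

/-- The dilation vector field `D = y^α ∂_α`. -/
def dilation (d : ℕ) : (Fin d → ℝ) → (Fin d → ℝ) := fun y => y

end HodgeDeRham

end

open HodgeDeRham

/-!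
The proof compares the two Laplacians through the extrinsic geometry of `Σ_n`.

Let `φ` be a local parametrisation, `e_i = ∂_i φ`, and `c = η(F, F) = ε H²`. Differentiating
`η(φ, φ) = 0` and `η(F, φ) = 1` shows that the tangent vectors `e_i` are orthogonal to `φ` and `F`,
whose Gram matrix `[[0, 1], [1, c]]` is invertible. Hence the induced metric `g` is nondegenerate,
`η⁻¹ = g^{ij} e_i ⊗ e_j - c φ ⊗ φ + φ ⊗ F + F ⊗ φ`
(`IsConeSection.sum_dualFrame_eq_trace`), and `Σ_n` is totally umbilic: the normal part of `∂_i e_j`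
is `g_{ij} ν` with `ν = c φ - F`, which is stated for the dual frame in
`IsConeSection.fderiv_dualFrame`.

The Hodge operators enter only through the coordinate formulas `codiff_one_apply` and
`codiff_two_apply` for the codifferential in degrees one and two. They follow from the
antiderivation property of the interior product and from the fact that `∗` is inverted explicitly
on forms of degree `d` and `d - 1`.

Combining the two, `-δ_Σ (φ^* a)` is the restriction of
`div a + n a(ν) + c (∂_D a)(D) - (∂_D a)(F) - (∂_F a)(D)`, and for `B = da` the one-form
`-δ_Σ (φ^* B)` is the pullback of
`div B + (n - 1) i_ν B + c (∂_D B)(D, ·) - (∂_D B)(F, ·) - (∂_F B)(D, ·)`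
(`IsConeSection.codiff_pullback_oneForm`, `IsConeSection.codiff_pullback_two`). No Christoffel
symbols are needed: their contributions cancel by the symmetry of second derivatives and the
antisymmetry of `B`. Since `d` commutes with pullback, the difference of the two Laplacians is the pullback of an
explicit form on `ℝ^(n + 2)`, and `L_D a = ∂_D a + a`, `L_F a = ∂_F a` and the symmetry of the
second derivative of `a` turn it into the asserted combination of Lie derivatives (`normal_terms_eq`). The
second form of the result follows from `[F, D] = F` (`lieDeriv_comm`). Stereographic projections
provide the parametrisations (`exists_isLocalParam`).
-/

namespace HodgeDeRham

section Hodge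

open ContinuousAlternatingMap Finset

variable {d : ℕ}

/-! ### Wedge products with interior products of a top-degree form -/

/-- A linear map is determined by its values on the standard basis. -/
theorem sum_smul_apply_single {G : Type*} [AddCommGroup G] [Module ℝ G] [TopologicalSpace G]
    (L : (Fin d → ℝ) →L[ℝ] G) (u : Fin d → ℝ) : ∑ b, u b • L (Pi.single b 1) = L u := by
  have h : u = ∑ b, u b • (Pi.single b 1 : Fin d → ℝ) := by simpa using pi_eq_sum_univ' u
  conv_rhs => rw [h, _root_.map_sum]
  simp

/-- The interior product is an antiderivation: `i_w (θ ∧ β) = θ(w) β - θ ∧ i_w β` for a covector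
`θ`, where `θ ∧ β` is `alternatizeUncurryFin (θ.smulRight β)`. -/
theorem curryLeft_wedge {k : ℕ} (θ : (Fin d → ℝ) →L[ℝ] ℝ) (β : Alt d (k + 1)) (w : Fin d → ℝ) :
    (alternatizeUncurryFin (θ.smulRight β)).curryLeft w =
      θ w • β - alternatizeUncurryFin (θ.smulRight (β.curryLeft w)) := by
  ext v
  have key : ∀ j : Fin (k + 1), Fin.removeNth j.succ (Matrix.vecCons w v) =
      Matrix.vecCons w (Fin.removeNth j v) := by
    intro j
    ext i : 1
    refine Fin.cases ?_ (fun i => ?_) i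
    · simp [Fin.removeNth]
    · simp [Fin.removeNth]
  have h0 : Fin.removeNth 0 (Matrix.vecCons w v) = v := by
    ext i : 1
    simp [Fin.removeNth]
  simp [alternatizeUncurryFin_apply, Fin.sum_univ_succ (n := k + 1), key, h0, pow_succ,
    Finset.sum_neg_distrib, sub_eq_add_neg]

theorem eq_zero_of_lt {k : ℕ} (hk : d < k) (β : Alt d k) : β = 0 := by
  ext v
  refine AlternatingMap.map_linearDependent β.toAlternatingMap v fun hv => ?_
  have := hv.fintype_card_le_finrank
  simp at this
  omega

/-- `θ ∧ i_w β = θ(w) β` for `β` of top degree, because `θ ∧ β` vanishes. -/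
theorem wedge_curryLeft_of_eq {k : ℕ} (h : k + 1 = d) (θ : (Fin d → ℝ) →L[ℝ] ℝ)
    (β : Alt d (k + 1)) (w : Fin d → ℝ) :
    alternatizeUncurryFin (θ.smulRight (β.curryLeft w)) = θ w • β := by
  have := curryLeft_wedge θ β w
  rw [eq_zero_of_lt (by omega) (alternatizeUncurryFin (θ.smulRight β)), curryLeft_zero,
    zero_apply] at this
  exact (sub_eq_zero.mp this.symm).symm

/-- `θ ∧ i_v i_u β = θ(v) i_u β - θ(u) i_v β` for `β` of top degree. -/
theorem wedge_curryLeft_curryLeft_of_eq {k : ℕ} (h : k + 2 = d) (θ : (Fin d → ℝ) →L[ℝ] ℝ)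
    (β : Alt d (k + 2)) (u v : Fin d → ℝ) :
    alternatizeUncurryFin (θ.smulRight ((β.curryLeft u).curryLeft v)) =
      θ v • β.curryLeft u - θ u • β.curryLeft v := by
  have h1 := curryLeft_wedge θ (β.curryLeft u) v
  rw [wedge_curryLeft_of_eq h, curryLeft_smul] at h1
  rw [eq_sub_iff_add_eq, ← sub_eq_iff_eq_add.mp h1.symm |>.symm]
  simp [add_comm]

theorem extDeriv_sum_smul {ι : Type*} [Fintype ι] {k : ℕ} {h : ι → (Fin d → ℝ) → ℝ}
    (c : ι → Alt d k) {x : Fin d → ℝ} (hh : ∀ s, DifferentiableAt ℝ (h s) x) :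
    extDeriv (fun y => ∑ s, h s y • c s) x =
      ∑ s, alternatizeUncurryFin ((fderiv ℝ (h s) x).smulRight (c s)) := by
  have : HasFDerivAt (fun y => ∑ s, h s y • c s) (∑ s, (fderiv ℝ (h s) x).smulRight (c s)) x :=
    HasFDerivAt.fun_sum fun s _ => (hh s).hasFDerivAt.smul_const (c s)
  rw [extDeriv, this.fderiv]
  exact map_sum (alternatizeUncurryFinCLM ℝ _ _) _ _

/-! ### The Hodge operator in degrees one and two -/

theorem contract_apply {q : ℕ} : ∀ (p : ℕ) (v : Fin p → Fin d → ℝ) (β : Alt d (q + p))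
    (w : Fin q → Fin d → ℝ), contract p v β w =
      β (fun i => if h : i.val < p then v ⟨i, h⟩ else w ⟨i - p, by omega⟩)
  | 0, v, β, w => by simp [contract]
  | p + 1, v, β, w => by
    rw [contract, contract_apply p, curryLeft_apply_apply]
    congr 1
    ext i : 1
    refine Fin.cases ?_ (fun i => ?_) i
    · simp
    · by_cases hi : i.val < p
      · simp [hi, Fin.tail]
      · simp [hi]

theorem hodge_one {k : ℕ} (h : k + 1 = d) (G : Matrix (Fin d) (Fin d) ℝ) (α : Alt d 1) :
    hodge G h α = ∑ s, (Real.sqrt |G.det| * α (fun _ => G⁻¹ s)) •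
      (detForm h).curryLeft (Pi.single s 1) := by
  unfold hodge
  rw [Nat.factorial_one, Nat.cast_one, inv_one, one_smul]
  refine Fintype.sum_equiv (Equiv.funUnique (Fin 1) (Fin d)) _ _ fun s => ?_
  have : (fun i => G⁻¹ (s i)) = fun _ => G⁻¹ ((Equiv.funUnique (Fin 1) (Fin d)) s) := by
    ext i : 1
    simp [Subsingleton.elim i 0]
  rw [this, mul_comm, mul_smul]
  rfl

theorem hodge_two {k : ℕ} (h : k + 2 = d) (G : Matrix (Fin d) (Fin d) ℝ) (α : Alt d 2) :
    hodge G h α = ∑ s : Fin d × Fin d, (2⁻¹ * (Real.sqrt |G.det| * α ![G⁻¹ s.1, G⁻¹ s.2])) •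
      ((detForm h).curryLeft (Pi.single s.1 1)).curryLeft (Pi.single s.2 1) := by
  unfold hodge
  rw [Nat.factorial_two, Nat.cast_two, Finset.smul_sum]
  refine Fintype.sum_equiv (finTwoArrowEquiv (Fin d)) _ _ fun s => ?_
  have : (fun i => G⁻¹ (s i)) = ![G⁻¹ (s 0), G⁻¹ (s 1)] := by
    ext i : 1
    fin_cases i <;> rfl
  rw [this, mul_comm (Real.sqrt _), mul_smul, mul_smul]
  rfl

/-! ### The inverse Hodge operator in degrees zero and one -/

theorem det_single_perm (σ : Equiv.Perm (Fin d)) :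
    (Matrix.of fun i => (Pi.single (σ i) 1 : Fin d → ℝ)).det = (Equiv.Perm.sign σ : ℝ) := by
  have := Matrix.det_permute (R := ℝ) σ 1
  rw [Matrix.det_one, mul_one] at this
  rw [← this]
  congr 1
  ext i j
  simp [Matrix.one_apply, Pi.single_apply, eq_comm]

theorem sign_mul_sign (σ : Equiv.Perm (Fin d)) :
    (Equiv.Perm.sign σ : ℝ) * (Equiv.Perm.sign σ : ℝ) = 1 := by
  rw [← Int.cast_mul, ← Units.val_mul, Int.units_mul_self]
  simp

/-- The determinant of a tuple of standard basis vectors is the sign of a permutation or zero, so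
that weighting a sum over tuples of indices by it leaves a signed sum over permutations. -/
theorem sum_det_mul (X : (Fin d → Fin d) → ℝ) :
    ∑ s : Fin d → Fin d, (Matrix.of fun i => (Pi.single (s i) 1 : Fin d → ℝ)).det * X s =
      ∑ σ : Equiv.Perm (Fin d), (Equiv.Perm.sign σ : ℝ) * X σ := by
  symm
  refine Finset.sum_of_injOn (fun σ => (σ : Fin d → Fin d)) (fun σ _ τ _ h => ?_) (by simp) ?_ ?_
  · exact DFunLike.coe_injective h
  · intro s _ hs
    have : ¬ Function.Injective s := fun hi => hs
      ⟨Equiv.ofBijective s (Finite.injective_iff_bijective.mp hi), by simp, rfl⟩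
    simp only [Function.Injective, not_forall] at this
    obtain ⟨i, j, hij, hne⟩ := this
    rw [Matrix.det_zero_of_row_eq hne (congrArg (fun t => (Pi.single t 1 : Fin d → ℝ)) hij),
      zero_mul]
  · intro σ _
    rw [det_single_perm]

theorem sum_perm_apply_zero {p : ℕ} (h : Fin (p + 1) → ℝ) :
    ∑ σ : Equiv.Perm (Fin (p + 1)), h (σ 0) = (p.factorial : ℝ) * ∑ a, h a := by
  rw [← Equiv.sum_comp (Equiv.Perm.decomposeFin (n := p)).symm, Fintype.sum_prod_type]
  simp [Fintype.card_perm, Finset.mul_sum]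

theorem detForm_apply (v : Fin d → Fin d → ℝ) : detForm rfl v = (Matrix.of v).det := rfl

theorem apply_vecCons_eq_sum {k : ℕ} (β : Alt d (k + 1)) (v : Fin d → ℝ) (u : Fin k → Fin d → ℝ) :
    β (Matrix.vecCons v u) = ∑ b, v b * β (Matrix.vecCons (Pi.single b 1) u) := by
  rw [← curryLeft_apply_apply, ← sum_smul_apply_single (curryLeft β) v]
  simp

/-- Replacing the first vector of a permuted standard basis by `v` multiplies the determinant by
the corresponding coordinate of `v`. -/
theorem detForm_vecCons_perm {p : ℕ} (σ : Equiv.Perm (Fin (p + 1))) (v : Fin (p + 1) → ℝ) :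
    detForm rfl (Matrix.vecCons v fun i : Fin p => (Pi.single (σ i.succ) 1 : Fin (p + 1) → ℝ)) =
      v (σ 0) * (Equiv.Perm.sign σ : ℝ) := by
  rw [apply_vecCons_eq_sum, Finset.sum_eq_single (σ 0)]
  · rw [← det_single_perm, detForm_apply]
    congr 2
    ext i : 1
    refine Fin.cases ?_ (fun i => ?_) i <;> simp
  · intro b _ hb
    obtain ⟨i, rfl⟩ := σ.surjective b
    obtain ⟨j, rfl⟩ : ∃ j : Fin p, j.succ = i :=
      Fin.exists_succ_eq.mpr fun h => hb (h ▸ rfl)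
    rw [ContinuousAlternatingMap.map_eq_zero_of_eq _ _ (i := 0) (j := j.succ) (by simp)
      (Fin.succ_ne_zero j).symm, mul_zero]
  · simp

/-- The `p`-forms `i_w ω` and `i_v ω` on `ℝ^(p + 1)` have Euclidean inner product `w ⬝ᵥ v`; summing
over all tuples instead of the increasing ones gives the factor `p!`. -/
theorem sum_detForm_mul_detForm {p : ℕ} (w v : Fin (p + 1) → ℝ) :
    ∑ s : Fin p → Fin (p + 1),
      detForm rfl (Matrix.vecCons w fun i : Fin p => (Pi.single (s i) 1 : Fin (p + 1) → ℝ)) *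
        detForm rfl (Matrix.vecCons v fun i : Fin p => (Pi.single (s i) 1 : Fin (p + 1) → ℝ)) =
      p.factorial * w ⬝ᵥ v := by
  have h1 := sum_det_mul (d := p + 1) fun t => w (t 0) *
    detForm rfl (Matrix.vecCons v fun i : Fin p => (Pi.single (t i.succ) 1 : Fin (p + 1) → ℝ))
  rw [← Equiv.sum_comp (Fin.consEquiv fun _ => Fin (p + 1)), Fintype.sum_prod_type,
    Finset.sum_comm] at h1
  trans ∑ σ : Equiv.Perm (Fin (p + 1)), w (σ 0) * v (σ 0)
  · convert h1 using 1
    · refine Finset.sum_congr rfl fun s _ => ?_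
      rw [apply_vecCons_eq_sum, Finset.sum_mul]
      refine Finset.sum_congr rfl fun a _ => ?_
      have : (Matrix.vecCons (Pi.single a 1) fun i : Fin p => (Pi.single (s i) 1 : Fin (p + 1) → ℝ))
          = fun i => Pi.single ((Fin.consEquiv fun _ => Fin (p + 1)) (a, s) i) 1 := by
        ext i : 1
        refine Fin.cases ?_ (fun i => ?_) i <;> simp
      rw [this, detForm_apply]
      simp only [Fin.consEquiv_apply, Fin.cons_zero, Fin.cons_succ]
      ring
    · refine Finset.sum_congr rfl fun σ _ => ?_
      rw [detForm_vecCons_perm]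
      linear_combination (-(w (σ 0) * v (σ 0))) * sign_mul_sign σ
  · rw [sum_perm_apply_zero (fun a => w a * v a)]
    rfl

theorem sign_mul_sqrt_abs_mul_inv {t : ℝ} (ht : t ≠ 0) :
    Real.sign t * (Real.sqrt |t| * t⁻¹) = (Real.sqrt |t|)⁻¹ := by
  have h1 : Real.sqrt |t| * Real.sqrt |t| = |t| := Real.mul_self_sqrt (abs_nonneg t)
  have h2 : Real.sqrt |t| ≠ 0 := (Real.sqrt_pos.mpr (abs_pos.mpr ht)).ne'
  have h3 : Real.sign t * |t| = t := by
    rcases lt_or_gt_of_ne ht with h | h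
    · rw [Real.sign_of_neg h, abs_of_neg h]; ring
    · rw [Real.sign_of_pos h, abs_of_pos h]; ring
  field_simp
  rw [sq, h1, h3]

/-- `∗⁻¹ (c dx^1 ∧ ⋯ ∧ dx^d) = c / √|det G|`. -/
theorem hodgeInv_detForm {p : ℕ} (h : 0 + p = d) (h' : p = d) {G : Matrix (Fin d) (Fin d) ℝ}
    (hG : G.det ≠ 0) (c : ℝ) (v : Fin 0 → Fin d → ℝ) :
    hodgeInv G h (c • detForm h') v = (Real.sqrt |G.det|)⁻¹ * c := by
  subst h'
  have hterm : ∀ s : Fin p → Fin p, (detForm rfl : Alt p p) (fun i => G⁻¹ (s i)) *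
      contract p (fun i => Pi.single (s i) 1) (volForm G h) v =
      Real.sqrt |G.det| * G.det⁻¹ *
        ((Matrix.of fun i => (Pi.single (s i) 1 : Fin p → ℝ)).det *
          (Matrix.of fun i => (Pi.single (s i) 1 : Fin p → ℝ)).det) := by
    intro s
    have e1 : (detForm rfl : Alt p p) (fun i => G⁻¹ (s i)) =
        (Matrix.of fun i => (Pi.single (s i) 1 : Fin p → ℝ)).det * G.det⁻¹ := by
      rw [detForm_apply, ← Ring.inverse_eq_inv', ← Matrix.det_nonsing_inv, ← Matrix.det_mul]
      congr 1
      ext i j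
      simp [Matrix.mul_apply, Pi.single_apply]
    have e2 : contract p (fun i => Pi.single (s i) 1) (volForm G h) v =
        Real.sqrt |G.det| * (Matrix.of fun i => (Pi.single (s i) 1 : Fin p → ℝ)).det := by
      rw [contract_apply, volForm, ContinuousAlternatingMap.smul_apply, smul_eq_mul]
      congr 1
      show Matrix.det _ = _
      congr 1
      ext i j
      simp
    rw [e1, e2]; ring
  have hsum : ∑ s : Fin p → Fin p, (Matrix.of fun i => (Pi.single (s i) 1 : Fin p → ℝ)).det *
      (Matrix.of fun i => (Pi.single (s i) 1 : Fin p → ℝ)).det = p.factorial := by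
    rw [sum_det_mul]
    simp [det_single_perm, sign_mul_sign, Fintype.card_perm]
  have hp : (p.factorial : ℝ) ≠ 0 := by positivity
  rw [hodgeInv, hodge]
  simp only [ContinuousAlternatingMap.smul_apply, ContinuousAlternatingMap.sum_apply, smul_eq_mul,
    mul_assoc c, hterm, ← Finset.mul_sum]
  rw [hsum, ← sign_mul_sqrt_abs_mul_inv hG, (Nat.even_mul_succ_self p).neg_one_pow]
  field_simp

/-- `∗⁻¹ (i_w (dx^1 ∧ ⋯ ∧ dx^d)) = G(w, ·) / √|det G|`. -/
theorem hodgeInv_curryLeft_detForm {p : ℕ} (h : 1 + p = d) (h' : p + 1 = d)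
    {G : Matrix (Fin d) (Fin d) ℝ} (hG : G.det ≠ 0) (w : Fin d → ℝ) (v : Fin 1 → Fin d → ℝ) :
    hodgeInv G h ((detForm h').curryLeft w) v =
      (Real.sqrt |G.det|)⁻¹ * (Matrix.vecMul w G ⬝ᵥ v 0) := by
  subst h'
  have hterm : ∀ s : Fin p → Fin (p + 1),
      (detForm rfl : Alt (p + 1) (p + 1)).curryLeft w (fun i => G⁻¹ (s i)) *
      contract p (fun i => Pi.single (s i) 1) (volForm G h) v =
      (-1) ^ p * (Real.sqrt |G.det| * G.det⁻¹) *
      (detForm rfl (Matrix.vecCons (Matrix.vecMul w G)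
          fun i : Fin p => (Pi.single (s i) 1 : Fin (p + 1) → ℝ)) *
        detForm rfl (Matrix.vecCons (v 0)
          fun i : Fin p => (Pi.single (s i) 1 : Fin (p + 1) → ℝ))) := by
    intro s
    have e1 : (detForm rfl : Alt (p + 1) (p + 1)).curryLeft w (fun i => G⁻¹ (s i)) =
        detForm rfl (Matrix.vecCons (Matrix.vecMul w G)
          fun i : Fin p => (Pi.single (s i) 1 : Fin (p + 1) → ℝ)) * G.det⁻¹ := by
      rw [curryLeft_apply_apply, detForm_apply, detForm_apply, ← Ring.inverse_eq_inv',
        ← Matrix.det_nonsing_inv, ← Matrix.det_mul]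
      congr 1
      ext i j
      refine Fin.cases ?_ (fun i => ?_) i
      · change w j = (Matrix.vecMul (Matrix.vecMul w G) G⁻¹) j
        rw [Matrix.vecMul_vecMul, Matrix.mul_nonsing_inv _ hG.isUnit, Matrix.vecMul_one]
      · simp [Matrix.mul_apply, Pi.single_apply]
    have e2 : contract p (fun i => Pi.single (s i) 1) (volForm G h) v =
        Real.sqrt |G.det| * ((-1) ^ p * detForm rfl (Matrix.vecCons (v 0)
          fun i : Fin p => (Pi.single (s i) 1 : Fin (p + 1) → ℝ))) := by
      rw [contract_apply, volForm, ContinuousAlternatingMap.smul_apply, smul_eq_mul]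
      congr 1
      -- `v` fills the last slot; moving it to the front costs the sign `(-1) ^ p` of the rotation,
      -- which cancels the sign in the definition of `hodgeInv`
      have hrot := Matrix.det_permute (R := ℝ) (finRotate (p + 1))
        (Matrix.of (Matrix.vecCons (v 0) fun i : Fin p => (Pi.single (s i) 1 : Fin (p + 1) → ℝ)))
      rw [sign_finRotate] at hrot
      rw [detForm_apply]
      simp only [Nat.add_sub_cancel, Units.val_pow_eq_pow_val, Units.val_neg, Units.val_one,
        Int.cast_pow, Int.cast_neg, Int.cast_one] at hrot
      rw [← hrot]
      show Matrix.det _ = _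
      congr 1
      ext i j
      have := congrFun (Fin.snoc_eq_cons_rotate
        (fun i : Fin p => (Pi.single (s i) 1 : Fin (p + 1) → ℝ)) (v 0)) i
      simp only [Matrix.submatrix_apply, Matrix.of_apply, id]
      refine Eq.trans ?_ (congrFun this j)
      refine Fin.lastCases ?_ (fun i => ?_) i
      · simp [Subsingleton.elim _ (0 : Fin 1)]
      · simp
    rw [e1, e2]; ring
  have hp : (p.factorial : ℝ) ≠ 0 := by positivity
  rw [hodgeInv, hodge]
  simp only [ContinuousAlternatingMap.smul_apply, ContinuousAlternatingMap.sum_apply, smul_eq_mul,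
    hterm, ← Finset.mul_sum]
  rw [sum_detForm_mul_detForm, ← sign_mul_sqrt_abs_mul_inv hG]
  have hpar : (-1 : ℝ) ^ (p * (p + 1 + 1)) * (-1) ^ p = 1 := by
    rw [← pow_add]
    refine Even.neg_one_pow ?_
    have := Nat.even_mul_succ_self p
    rw [Nat.even_iff] at this ⊢
    rw [show p * (p + 1 + 1) + p = p * (p + 1) + 2 * p by ring]
    omega
  field_simp
  linear_combination (Real.sign G.det * (Matrix.vecMul w G ⬝ᵥ v 0)) * hpar

/-! ### The codifferential in coordinates -/

theorem extDeriv_hodge_one {k : ℕ} (h : k + 1 = d) (g : Metric d) (α : DForm d 1) {x : Fin d → ℝ}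
    (hα : ∀ s, DifferentiableAt ℝ
      (fun y => Real.sqrt |(g y).det| * α y (fun _ => (g y)⁻¹ s)) x) :
    extDeriv (fun y => hodge (q := k) (g y) h (α y)) x =
      (∑ s, fderiv ℝ (fun y => Real.sqrt |(g y).det| * α y (fun _ => (g y)⁻¹ s)) x
        (Pi.single s 1)) • detForm h := by
  simp only [hodge_one]
  rw [extDeriv_sum_smul _ hα, Finset.sum_smul]
  exact Finset.sum_congr rfl fun s _ => wedge_curryLeft_of_eq h _ _ _

/-- `δ α = -(1 / √|g|) ∂_s (√|g| g^{st} α_t)` for a one-form `α`. -/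
theorem codiff_one_apply (hd : 1 ≤ d) (g : Metric d) (α : DForm d 1) {x : Fin d → ℝ}
    (hg : (g x).det ≠ 0)
    (hα : ∀ s, DifferentiableAt ℝ
      (fun y => Real.sqrt |(g y).det| * α y (fun _ => (g y)⁻¹ s)) x) (v : Fin 0 → Fin d → ℝ) :
    codiff g α x v = -((Real.sqrt |(g x).det|)⁻¹ *
      ∑ s, fderiv ℝ (fun y => Real.sqrt |(g y).det| * α y (fun _ => (g y)⁻¹ s)) x
        (Pi.single s 1)) := by
  rw [codiff, dif_pos (by omega), extDeriv_hodge_one _ g α hα, ContinuousAlternatingMap.smul_apply,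
    hodgeInv_detForm _ _ hg]
  simp

theorem apply_swap (B : Alt d 2) (u v : Fin d → ℝ) : B ![v, u] = -B ![u, v] := by
  have h := B.toAlternatingMap.map_swap ![u, v] (zero_ne_one (α := Fin 2))
  have e : (![u, v] ∘ Equiv.swap (0 : Fin 2) 1) = ![v, u] := by
    ext l : 1
    fin_cases l <;> simp
  rw [e] at h
  exact h

theorem extDeriv_hodge_two {k : ℕ} (h : k + 2 = d) (g : Metric d) (B : DForm d 2) {x : Fin d → ℝ}
    (hB : ∀ i j, DifferentiableAt ℝ
      (fun y => Real.sqrt |(g y).det| * B y ![(g y)⁻¹ i, (g y)⁻¹ j]) x) :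
    extDeriv (fun y => hodge (q := k) (g y) h (B y)) x =
      (detForm (k := k + 1 + 1) h).curryLeft (-fun j => ∑ i, fderiv ℝ
        (fun y => Real.sqrt |(g y).det| * B y ![(g y)⁻¹ i, (g y)⁻¹ j]) x (Pi.single i 1)) := by
  set b : Fin d → Fin d → (Fin d → ℝ) → ℝ :=
    fun i j y => Real.sqrt |(g y).det| * B y ![(g y)⁻¹ i, (g y)⁻¹ j] with hb
  have hanti : ∀ i j, b j i = -b i j := by
    intro i j
    ext y
    show Real.sqrt _ * B y _ = -(Real.sqrt _ * B y _)
    rw [apply_swap, mul_neg]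
  have hB' : ∀ s : Fin d × Fin d, DifferentiableAt ℝ (fun y => 2⁻¹ * b s.1 s.2 y) x :=
    fun s => (hB s.1 s.2).const_mul _
  have hodge_eq : (fun y => hodge (q := k) (g y) h (B y)) = fun y => ∑ s : Fin d × Fin d,
      (2⁻¹ * b s.1 s.2 y) • ((detForm (k := k + 1 + 1) h).curryLeft
        (Pi.single s.1 1)).curryLeft (Pi.single s.2 1) :=
    funext fun y => hodge_two h (g y) (B y)
  replace hB : ∀ i j, DifferentiableAt ℝ (b i j) x := hB
  change _ = (detForm (k := k + 1 + 1) h).curryLeft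
    (-fun j => ∑ i, fderiv ℝ (b i j) x (Pi.single i 1))
  clear_value b
  rw [hodge_eq, extDeriv_sum_smul _ hB']
  rw [← sum_smul_apply_single]
  have hterm : ∀ s : Fin d × Fin d,
      alternatizeUncurryFin ((fderiv ℝ (fun y => 2⁻¹ * b s.1 s.2 y) x).smulRight
        (((detForm (k := k + 1 + 1) h).curryLeft (Pi.single s.1 1)).curryLeft
          (Pi.single s.2 1))) =
      -((2⁻¹ * fderiv ℝ (b s.2 s.1) x (Pi.single s.2 1)) •
        (detForm (k := k + 1 + 1) h).curryLeft (Pi.single s.1 1)) -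
      (2⁻¹ * fderiv ℝ (b s.1 s.2) x (Pi.single s.1 1)) •
        (detForm (k := k + 1 + 1) h).curryLeft (Pi.single s.2 1) := by
    intro s
    rw [wedge_curryLeft_curryLeft_of_eq h, fderiv_const_mul (hB s.1 s.2), hanti s.1 s.2, fderiv_neg]
    simp
  refine (Finset.sum_congr rfl fun s _ => hterm s).trans ?_
  rw [Finset.sum_sub_distrib, Finset.sum_neg_distrib, Fintype.sum_prod_type,
    Fintype.sum_prod_type, Finset.sum_comm (γ := Fin d) (s := univ) (t := univ)
      (f := fun i j => (2⁻¹ * fderiv ℝ (b i j) x (Pi.single i 1)) •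
        (detForm (k := k + 1 + 1) h).curryLeft (Pi.single j 1))]
  simp only [Pi.neg_apply, neg_smul, Finset.sum_neg_distrib, ← Finset.sum_smul, ← Finset.mul_sum]
  rw [← neg_add', ← Finset.sum_add_distrib]
  congr 1
  refine Finset.sum_congr rfl fun j _ => ?_
  rw [← add_smul]
  congr 1
  ring

/-- `(δ B)_k = -(1 / √|g|) ∂_i (√|g| B^{ij}) g_{jk}` for a two-form `B`, in every dimension: in
dimensions less than two both sides vanish. -/
theorem codiff_two_apply (g : Metric d) (B : DForm d 2) {x : Fin d → ℝ}
    (hg : (g x).det ≠ 0)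
    (hB : ∀ i j, DifferentiableAt ℝ
      (fun y => Real.sqrt |(g y).det| * B y ![(g y)⁻¹ i, (g y)⁻¹ j]) x) (v : Fin 1 → Fin d → ℝ) :
    codiff g B x v = -((Real.sqrt |(g x).det|)⁻¹ *
      (Matrix.vecMul (fun j => ∑ i, fderiv ℝ
        (fun y => Real.sqrt |(g y).det| * B y ![(g y)⁻¹ i, (g y)⁻¹ j]) x (Pi.single i 1)) (g x)
          ⬝ᵥ v 0)) := by
  by_cases hd : 2 ≤ d
  · rw [codiff, dif_pos (by omega), extDeriv_hodge_two _ g B hB,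
      ContinuousAlternatingMap.smul_apply, hodgeInv_curryLeft_detForm _ _ hg]
    simp [Matrix.neg_vecMul]
  · rw [codiff, dif_neg (by omega)]
    have : B = 0 := funext fun y => eq_zero_of_lt (by omega) (B y)
    subst this
    have : (fun j : Fin d => ∑ i, fderiv ℝ (fun y => Real.sqrt |(g y).det| *
        (0 : DForm d 2) y ![(g y)⁻¹ i, (g y)⁻¹ j]) x (Pi.single i 1)) = 0 := by
      ext j
      simp
    rw [this]
    simp

end Hodge

section Restriction

open scoped Matrix

variable {d m : ℕ}

/-! ### Derivatives of determinants and inverse matrices -/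

theorem contDiffAt_det {r : ℕ∞ω} {g : (Fin m → ℝ) → Matrix (Fin d) (Fin d) ℝ} {x : Fin m → ℝ}
    (hg : ∀ i j, ContDiffAt ℝ r (fun y => g y i j) x) : ContDiffAt ℝ r (fun y => (g y).det) x := by
  simp only [Matrix.det_apply']
  exact ContDiffAt.sum fun σ _ => contDiffAt_const.mul (contDiffAt_prod fun i _ => hg _ _)

theorem contDiffAt_inv_apply {r : ℕ∞ω} {g : (Fin m → ℝ) → Matrix (Fin d) (Fin d) ℝ}
    {x : Fin m → ℝ} (hg : ∀ i j, ContDiffAt ℝ r (fun y => g y i j) x) (hx : (g x).det ≠ 0)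
    (i j : Fin d) : ContDiffAt ℝ r (fun y => (g y)⁻¹ i j) x := by
  simp only [Matrix.inv_def, Ring.inverse_eq_inv', Matrix.smul_apply, smul_eq_mul,
    Matrix.adjugate_apply]
  refine ((contDiffAt_det hg).inv hx).mul (contDiffAt_det fun k l => ?_)
  by_cases hk : k = j
  · subst hk
    simp only [Matrix.updateRow_self]
    exact contDiffAt_const
  · simp only [Matrix.updateRow_ne hk]
    exact hg k l

theorem contDiffAt_sqrt_abs_det {r : ℕ∞} {g : (Fin m → ℝ) → Matrix (Fin d) (Fin d) ℝ}
    {x : Fin m → ℝ} (hg : ∀ i j, ContDiffAt ℝ r (fun y => g y i j) x) (hx : (g x).det ≠ 0) :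
    ContDiffAt ℝ r (fun y => Real.sqrt |(g y).det|) x :=
  ((contDiffAt_det hg).abs hx).sqrt (abs_pos.mpr hx).ne'

/-- Jacobi's formula `d (det g) = tr (adj(g) dg)`. -/
theorem hasFDerivAt_det {g : (Fin m → ℝ) → Matrix (Fin d) (Fin d) ℝ} {x : Fin m → ℝ}
    (hg : ∀ i j, DifferentiableAt ℝ (fun y => g y i j) x) :
    HasFDerivAt (fun y => (g y).det)
      (∑ i, ∑ j, (g x).adjugate i j • fderiv ℝ (fun y => g y j i) x) x := by
  have h1 : HasFDerivAt (fun y => (g y : Fin d → Fin d → ℝ))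
      (ContinuousLinearMap.pi fun i => ContinuousLinearMap.pi fun j =>
        fderiv ℝ (fun y => g y i j) x) x :=
    hasFDerivAt_pi.mpr fun i => hasFDerivAt_pi.mpr fun j => (hg i j).hasFDerivAt
  have h2 : HasFDerivAt (fun y => (g y).det) _ x :=
    ((detForm (d := d) rfl).toContinuousMultilinearMap.hasFDerivAt (g x)).comp x h1
  refine h2.congr_fderiv ?_
  ext v
  refine (ContinuousMultilinearMap.linearDeriv_apply _ _ _).trans ?_
  rw [Finset.sum_comm]
  simp only [_root_.sum_apply, _root_.smul_apply]
  refine Finset.sum_congr rfl fun j _ => ?_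
  trans ((g x).updateRow j fun i => fderiv ℝ (fun y => g y j i) x v).det
  · rfl
  rw [← Matrix.cramer_transpose_apply, Matrix.cramer_eq_adjugate_mulVec,
    ← Matrix.adjugate_transpose]
  rfl

theorem fderiv_sqrt_abs_det_apply {g : (Fin m → ℝ) → Matrix (Fin d) (Fin d) ℝ} {x : Fin m → ℝ}
    (hg : ∀ i j, DifferentiableAt ℝ (fun y => g y i j) x) (hx : (g x).det ≠ 0) (v : Fin m → ℝ) :
    fderiv ℝ (fun y => Real.sqrt |(g y).det|) x v =
      Real.sqrt |(g x).det| *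
        (2⁻¹ * ∑ i, ∑ j, (g x)⁻¹ i j * fderiv ℝ (fun y => g y j i) x v) := by
  have h3 : HasDerivAt (fun t : ℝ => Real.sqrt |t|) _ (g x).det :=
    (hasDerivAt_abs hx).sqrt (abs_pos.mpr hx).ne'
  have h4 : HasFDerivAt (fun y => Real.sqrt |(g y).det|) _ x :=
    HasDerivAt.comp_hasFDerivAt (h₂ := fun t : ℝ => Real.sqrt |t|) x h3 (hasFDerivAt_det hg)
  rw [h4.fderiv]
  simp only [_root_.smul_apply, _root_.sum_apply, smul_eq_mul, Matrix.inv_def, Ring.inverse_eq_inv',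
    Matrix.smul_apply, mul_assoc, ← Finset.mul_sum]
  set t := (g x).det
  have e1 : Real.sqrt |t| * Real.sqrt |t| = |t| := Real.mul_self_sqrt (abs_nonneg t)
  have e2 : Real.sqrt |t| ≠ 0 := (Real.sqrt_pos.mpr (abs_pos.mpr hx)).ne'
  have e3 : (SignType.sign t : ℝ) * t = |t| := sign_mul_self t
  generalize (∑ i, ∑ j, (g x).adjugate i j * fderiv ℝ (fun y => g y j i) x v) = S
  field_simp
  linear_combination S * e3 - S * e1

/-- Raising the index of a covector with `G⁻¹` and lowering it with `G` gives the covector back. -/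
theorem vecMul_inv_dotProduct (G : Matrix (Fin d) (Fin d) ℝ) (hG : G.det ≠ 0) (hs : Gᵀ = G)
    (L : (Fin d → ℝ) →L[ℝ] ℝ) (v : Fin d → ℝ) :
    Matrix.vecMul (fun j => L (G⁻¹ j)) G ⬝ᵥ v = L v := by
  rw [← Matrix.dotProduct_mulVec]
  have : v = ∑ j, (G.mulVec v) j • G⁻¹ j := by
    have h : Matrix.vecMul (G.mulVec v) G⁻¹ = v := by
      rw [← Matrix.vecMul_transpose, hs, Matrix.vecMul_vecMul, Matrix.mul_nonsing_inv _ hG.isUnit,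
        Matrix.vecMul_one]
    rw [Matrix.vecMul_eq_sum] at h
    exact h.symm
  conv_rhs => rw [this, _root_.map_sum]
  simp only [map_smul, smul_eq_mul, dotProduct]
  exact Finset.sum_congr rfl fun _ _ => mul_comm _ _

/-! ### Extrinsic geometry of a section of the null cone -/

/-- The bilinear form with Gram matrix `η`, as a continuous bilinear map. -/
noncomputable def gramForm (η : Matrix (Fin d) (Fin d) ℝ) :
    (Fin d → ℝ) →L[ℝ] (Fin d → ℝ) →L[ℝ] ℝ :=
  LinearMap.toContinuousBilinearMap (Matrix.toBilin' η)

theorem gramForm_apply (η : Matrix (Fin d) (Fin d) ℝ) (u v : Fin d → ℝ) :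
    gramForm η u v = u ⬝ᵥ η *ᵥ v :=
  Matrix.toBilin'_apply' η u v

theorem gramForm_comm {η : Matrix (Fin d) (Fin d) ℝ} (hs : ηᵀ = η) (u v : Fin d → ℝ) :
    gramForm η u v = gramForm η v u := by
  rw [gramForm_apply, gramForm_apply, Matrix.dotProduct_mulVec, ← Matrix.mulVec_transpose, hs,
    dotProduct_comm]

theorem gramForm_inv_row {η : Matrix (Fin d) (Fin d) ℝ} (hd : η.det ≠ 0) (s : Fin d)
    (v : Fin d → ℝ) : gramForm η (η⁻¹ s) v = v s := by
  rw [gramForm_apply, Matrix.dotProduct_mulVec]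
  have : Matrix.vecMul (η⁻¹ s) η = Pi.single s 1 := by
    ext j
    have := congrFun (congrFun (Matrix.nonsing_inv_mul η hd.isUnit) s) j
    rw [Matrix.mul_apply] at this
    simpa [Matrix.vecMul, dotProduct, Matrix.one_apply, Pi.single_apply, eq_comm] using this
  rw [this, single_dotProduct, one_mul]

theorem eq_zero_of_gramForm_eq_zero {η : Matrix (Fin d) (Fin d) ℝ} (hd : η.det ≠ 0)
    {w : Fin d → ℝ} (h : ∀ u, gramForm η u w = 0) : w = 0 := by
  ext s
  rw [← gramForm_inv_row hd s w, h, Pi.zero_apply]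

theorem fderiv_gramForm (η : Matrix (Fin d) (Fin d) ℝ)
    {a b : (Fin m → ℝ) → Fin d → ℝ} {x : Fin m → ℝ} (ha : DifferentiableAt ℝ a x)
    (hb : DifferentiableAt ℝ b x) (v : Fin m → ℝ) :
    fderiv ℝ (fun y => gramForm η (a y) (b y)) x v =
      gramForm η (fderiv ℝ a x v) (b x) + gramForm η (a x) (fderiv ℝ b x v) := by
  have := (gramForm η).hasFDerivAt_of_bilinear ha.hasFDerivAt hb.hasFDerivAt
  rw [this.fderiv]
  simp [add_comm]

theorem inducedMetric_apply (η : Matrix (Fin d) (Fin d) ℝ) (φ : (Fin m → ℝ) → Fin d → ℝ)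
    (x : Fin m → ℝ) (i j : Fin m) : inducedMetric η φ x i j =
      gramForm η (fderiv ℝ φ x (Pi.single i 1)) (fderiv ℝ φ x (Pi.single j 1)) :=
  (gramForm_apply _ _ _).symm

theorem gramForm_inducedMetric (η : Matrix (Fin d) (Fin d) ℝ) (φ : (Fin m → ℝ) → Fin d → ℝ)
    (x u v : Fin m → ℝ) : gramForm (inducedMetric η φ x) u v =
      gramForm η (fderiv ℝ φ x u) (fderiv ℝ φ x v) := by
  rw [← sum_smul_apply_single (fderiv ℝ φ x) u, ← sum_smul_apply_single (fderiv ℝ φ x) v]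
  simp only [map_sum, map_smul, sum_apply, smul_apply, smul_eq_mul,
    ← inducedMetric_apply]
  rw [gramForm_apply, dotProduct]
  simp only [Matrix.mulVec, dotProduct, Finset.mul_sum]
  rw [Finset.sum_comm]
  refine Finset.sum_congr rfl fun i _ => Finset.sum_congr rfl fun j _ => by ring

/-- `φ` is a smooth immersion of the open set `U ⊆ ℝ^m` into the intersection of the null cone of a
nondegenerate symmetric form `η` on `ℝ^(m + 2)` with the hyperplane `η(F, y) = 1`, where
`η(F, F) = c`. -/
structure IsConeSection (η : Matrix (Fin (m + 2)) (Fin (m + 2)) ℝ) (F : Fin (m + 2) → ℝ) (c : ℝ)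
    (U : Set (Fin m → ℝ)) (φ : (Fin m → ℝ) → Fin (m + 2) → ℝ) : Prop where
  transpose_eq : ηᵀ = η
  det_ne : η.det ≠ 0
  sq : gramForm η F F = c
  isOpen : IsOpen U
  smooth : ContDiffOn ℝ ∞ φ U
  null : ∀ x ∈ U, gramForm η (φ x) (φ x) = 0
  height : ∀ x ∈ U, gramForm η F (φ x) = 1
  immersion : ∀ x ∈ U, Function.Injective (fderiv ℝ φ x)

namespace IsConeSection

variable {η : Matrix (Fin (m + 2)) (Fin (m + 2)) ℝ} {F : Fin (m + 2) → ℝ} {c : ℝ}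
    {U : Set (Fin m → ℝ)} {φ : (Fin m → ℝ) → Fin (m + 2) → ℝ} {x : Fin m → ℝ}

theorem comm (h : IsConeSection η F c U φ) (u v : Fin (m + 2) → ℝ) :
    gramForm η u v = gramForm η v u := gramForm_comm h.transpose_eq u v

theorem contDiffAt (h : IsConeSection η F c U φ) (hx : x ∈ U) : ContDiffAt ℝ ∞ φ x :=
  h.smooth.contDiffAt (h.isOpen.mem_nhds hx)

theorem differentiableAt (h : IsConeSection η F c U φ) (hx : x ∈ U) : DifferentiableAt ℝ φ x :=
  (h.contDiffAt hx).differentiableAt (by simp)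

theorem contDiffAt_fderiv (h : IsConeSection η F c U φ) (hx : x ∈ U) :
    ContDiffAt ℝ ∞ (fderiv ℝ φ) x :=
  (h.contDiffAt hx).fderiv_right (by simp)

theorem differentiableAt_fderiv (h : IsConeSection η F c U φ) (hx : x ∈ U) :
    DifferentiableAt ℝ (fderiv ℝ φ) x :=
  (h.contDiffAt_fderiv hx).differentiableAt (by simp)

theorem fderiv_fderiv_comm (h : IsConeSection η F c U φ) (hx : x ∈ U) (u v : Fin m → ℝ) :
    fderiv ℝ (fderiv ℝ φ) x u v = fderiv ℝ (fderiv ℝ φ) x v u :=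
  (h.contDiffAt hx).isSymmSndFDerivAt (by simpa using (mod_cast le_top : ((2 : ℕ∞) : ℕ∞ω) ≤ ∞)) u v

/-- A function that is constant on `U` has derivative zero there. -/
theorem fderiv_eq_zero_of_eqOn (h : IsConeSection η F c U φ) (hx : x ∈ U) {a : (Fin m → ℝ) → ℝ}
    {k : ℝ} (ha : ∀ y ∈ U, a y = k) : fderiv ℝ a x = 0 := by
  have : a =ᶠ[nhds x] fun _ => k := Filter.eventually_of_mem (h.isOpen.mem_nhds hx) ha
  rw [this.fderiv_eq, fderiv_fun_const, Pi.zero_apply]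

theorem gramForm_tangent_self (h : IsConeSection η F c U φ) (hx : x ∈ U) (v : Fin m → ℝ) :
    gramForm η (fderiv ℝ φ x v) (φ x) = 0 := by
  have h1 := fderiv_gramForm η (h.differentiableAt hx) (h.differentiableAt hx) v
  rw [h.fderiv_eq_zero_of_eqOn hx h.null, h.comm (φ x), zero_apply] at h1
  linarith

theorem gramForm_tangent_const (h : IsConeSection η F c U φ) (hx : x ∈ U) (v : Fin m → ℝ) :
    gramForm η (fderiv ℝ φ x v) F = 0 := by
  have h1 := fderiv_gramForm η (differentiableAt_const F) (h.differentiableAt hx) v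
  rw [h.fderiv_eq_zero_of_eqOn hx h.height] at h1
  simpa [h.comm F] using h1.symm

theorem gramForm_self_const (h : IsConeSection η F c U φ) (hx : x ∈ U) :
    gramForm η (φ x) F = 1 := by rw [h.comm, h.height x hx]

/-- The tangent vectors, the position vector and `F` are independent: the Gram matrix of the
latter two, `[[0, 1], [1, c]]`, is invertible, and both are orthogonal to the tangent space. -/
theorem frame_injective (h : IsConeSection η F c U φ) (hx : x ∈ U) {v : Fin m → ℝ} {s t : ℝ}
    (h0 : fderiv ℝ φ x v + s • φ x + t • F = 0) : v = 0 ∧ s = 0 ∧ t = 0 := by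
  have h1 := congrArg (gramForm η (φ x)) h0
  have h2 := congrArg (gramForm η F) h0
  simp only [map_add, map_smul, smul_eq_mul, map_zero, h.null x hx, h.height x hx, h.sq,
    h.gramForm_self_const hx, h.comm _ (fderiv ℝ φ x v), h.gramForm_tangent_self hx,
    h.gramForm_tangent_const hx] at h1 h2
  have ht : t = 0 := by linarith
  subst ht
  have hs : s = 0 := by linarith
  subst hs
  refine ⟨h.immersion x hx ?_, rfl, rfl⟩
  simpa using h0

/-- The tangent vectors, the position vector and `F` span `ℝ^(m + 2)`. -/
theorem frame_surjective (h : IsConeSection η F c U φ) (hx : x ∈ U) (X : Fin (m + 2) → ℝ) :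
    ∃ (v : Fin m → ℝ) (s t : ℝ), fderiv ℝ φ x v + s • φ x + t • F = X := by
  let A : ((Fin m → ℝ) × ℝ × ℝ) →ₗ[ℝ] (Fin (m + 2) → ℝ) :=
    (fderiv ℝ φ x).toLinearMap.coprod
      ((LinearMap.toSpanSingleton ℝ _ (φ x)).coprod (LinearMap.toSpanSingleton ℝ _ F))
  have hA : Function.Injective A := by
    rw [← LinearMap.ker_eq_bot, LinearMap.ker_eq_bot']
    rintro ⟨v, s, t⟩ hv
    obtain ⟨rfl, rfl, rfl⟩ := h.frame_injective hx (v := v) (s := s) (t := t)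
      (by simpa [A, add_assoc] using hv)
    rfl
  obtain ⟨⟨v, s, t⟩, hv⟩ := (LinearMap.injective_iff_surjective_of_finrank_eq_finrank
    (by simp)).mp hA X
  exact ⟨v, s, t, by simpa [A, add_assoc] using hv⟩

theorem eq_zero_of_orthogonal (h : IsConeSection η F c U φ) (hx : x ∈ U) {X : Fin (m + 2) → ℝ}
    (h1 : ∀ v, gramForm η (fderiv ℝ φ x v) X = 0) (h2 : gramForm η (φ x) X = 0)
    (h3 : gramForm η F X = 0) : X = 0 := by
  refine eq_zero_of_gramForm_eq_zero h.det_ne fun u => ?_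
  obtain ⟨v, s, t, rfl⟩ := h.frame_surjective hx u
  simp [h1, h2, h3]

theorem inducedMetric_transpose (h : IsConeSection η F c U φ) (x : Fin m → ℝ) :
    (inducedMetric η φ x)ᵀ = inducedMetric η φ x := by
  ext i j
  rw [Matrix.transpose_apply, inducedMetric_apply, inducedMetric_apply, h.comm]

theorem inducedMetric_det_ne (h : IsConeSection η F c U φ) (hx : x ∈ U) :
    (inducedMetric η φ x).det ≠ 0 := by
  intro h0
  obtain ⟨v, hv, hv0⟩ := Matrix.exists_mulVec_eq_zero_iff.mpr h0
  refine hv ?_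
  have : fderiv ℝ φ x v = 0 := by
    refine h.eq_zero_of_orthogonal hx (fun u => ?_) ?_ ?_
    · rw [← gramForm_inducedMetric, gramForm_apply, hv0, dotProduct_zero]
    · rw [h.comm, h.gramForm_tangent_self hx]
    · rw [h.comm, h.gramForm_tangent_const hx]
  exact h.immersion x hx (this.trans (map_zero _).symm)

theorem contDiffAt_inducedMetric (h : IsConeSection η F c U φ) (hx : x ∈ U) (i j : Fin m) :
    ContDiffAt ℝ ∞ (fun y => inducedMetric η φ y i j) x := by
  simp only [inducedMetric_apply]
  have h1 := fun k : Fin m => (h.contDiffAt_fderiv hx).clm_apply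
    (contDiffAt_const (c := (Pi.single k 1 : Fin m → ℝ)))
  exact ((gramForm η).contDiff.contDiffAt.comp x (h1 i)).clm_apply (h1 j)

end IsConeSection

/-- The dual frame `e^l = g^{lk} e_k` of the coordinate frame `e_k = ∂_k φ`, as a field of vectors
of the ambient space. -/
noncomputable def dualFrame {d : ℕ} (η : Matrix (Fin d) (Fin d) ℝ) (φ : (Fin m → ℝ) → Fin d → ℝ)
    (l : Fin m) (y : Fin m → ℝ) : Fin d → ℝ :=
  fderiv ℝ φ y ((inducedMetric η φ y)⁻¹ l)

namespace IsConeSection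

variable {η : Matrix (Fin (m + 2)) (Fin (m + 2)) ℝ} {F : Fin (m + 2) → ℝ} {c : ℝ}
    {U : Set (Fin m → ℝ)} {φ : (Fin m → ℝ) → Fin (m + 2) → ℝ} {x : Fin m → ℝ}

theorem gramForm_dualFrame (h : IsConeSection η F c U φ) (hx : x ∈ U) (l : Fin m) (v : Fin m → ℝ) :
    gramForm η (dualFrame η φ l x) (fderiv ℝ φ x v) = v l := by
  rw [dualFrame, ← gramForm_inducedMetric, gramForm_inv_row (h.inducedMetric_det_ne hx)]

theorem gramForm_dualFrame_self (h : IsConeSection η F c U φ) (hx : x ∈ U) (l : Fin m) :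
    gramForm η (dualFrame η φ l x) (φ x) = 0 :=
  h.gramForm_tangent_self hx _

theorem gramForm_dualFrame_const (h : IsConeSection η F c U φ) (hx : x ∈ U) (l : Fin m) :
    gramForm η (dualFrame η φ l x) F = 0 :=
  h.gramForm_tangent_const hx _

theorem differentiableAt_dualFrame (h : IsConeSection η F c U φ) (hx : x ∈ U) (l : Fin m) :
    DifferentiableAt ℝ (dualFrame η φ l) x := by
  refine (h.differentiableAt_fderiv hx).clm_apply (differentiableAt_pi.mpr fun j => ?_)
  exact (contDiffAt_inv_apply (h.contDiffAt_inducedMetric hx)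
    (h.inducedMetric_det_ne hx) l j).differentiableAt (by simp)

/-- Expansion of an ambient vector in the dual frame, the position vector and `F`. The coefficients
of the last two come from the inverse `[[-c, 1], [1, 0]]` of their Gram matrix. -/
theorem eq_sum_dualFrame (h : IsConeSection η F c U φ) (hx : x ∈ U) (X : Fin (m + 2) → ℝ) :
    X = ∑ k, gramForm η X (fderiv ℝ φ x (Pi.single k 1)) • dualFrame η φ k x
      + (gramForm η X F - c * gramForm η X (φ x)) • φ x + gramForm η X (φ x) • F := by
  rw [← sub_eq_zero]
  refine h.eq_zero_of_orthogonal hx (fun v => ?_) ?_ ?_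
  · simp only [map_sub, map_add, map_smul, smul_eq_mul, map_sum,
      h.gramForm_tangent_self hx, h.gramForm_tangent_const hx,
      h.comm (fderiv ℝ φ x v) (dualFrame η φ _ x), h.gramForm_dualFrame hx]
    rw [h.comm (fderiv ℝ φ x v) X, ← sum_smul_apply_single (fderiv ℝ φ x) v]
    simp [mul_comm]
  · simp only [map_sub, map_add, map_smul, smul_eq_mul, map_sum, dualFrame,
      h.comm (φ x) (fderiv ℝ φ x _), h.gramForm_tangent_self hx, h.null x hx,
      h.gramForm_self_const hx, h.comm (φ x) X]
    simp
  · simp only [map_sub, map_add, map_smul, smul_eq_mul, map_sum, dualFrame,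
      h.comm F (fderiv ℝ φ x _), h.gramForm_tangent_const hx, h.height x hx, h.sq, h.comm F X]
    simp
    ring

/-- The derivative of the dual frame: `∂_i e^l = δ_i^l (c φ - F) - η(e^l, ∂_i e_k) e^k`. The normal
part says that the second fundamental form is `g ⊗ (c φ - F)`. -/
theorem fderiv_dualFrame (h : IsConeSection η F c U φ) (hx : x ∈ U) (l : Fin m) (v : Fin m → ℝ) :
    fderiv ℝ (dualFrame η φ l) x v = v l • (c • φ x - F) -
      ∑ k, gramForm η (dualFrame η φ l x)
        (fderiv ℝ (fderiv ℝ φ) x v (Pi.single k 1)) • dualFrame η φ k x := by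
  have hd := h.differentiableAt_dualFrame hx l
  have h1 : ∀ k, gramForm η (fderiv ℝ (dualFrame η φ l) x v) (fderiv ℝ φ x (Pi.single k 1)) =
      -gramForm η (dualFrame η φ l x) (fderiv ℝ (fderiv ℝ φ) x v (Pi.single k 1)) := by
    intro k
    have e := fderiv_gramForm η hd
      ((h.differentiableAt_fderiv hx).clm_apply (differentiableAt_const (Pi.single k 1))) v
    rw [h.fderiv_eq_zero_of_eqOn hx (k := (Pi.single k 1 : Fin m → ℝ) l)
        fun y hy => h.gramForm_dualFrame hy l _,
      fderiv_clm_apply (h.differentiableAt_fderiv hx) (differentiableAt_const _)] at e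
    simp at e
    linarith
  have h2 : gramForm η (fderiv ℝ (dualFrame η φ l) x v) (φ x) = -v l := by
    have e := fderiv_gramForm η hd (h.differentiableAt hx) v
    rw [h.fderiv_eq_zero_of_eqOn hx (k := 0)
        fun y hy => h.gramForm_dualFrame_self hy l,
      h.gramForm_dualFrame hx, zero_apply] at e
    linarith
  have h3 : gramForm η (fderiv ℝ (dualFrame η φ l) x v) F = 0 := by
    have e := fderiv_gramForm η hd (differentiableAt_const F) v
    rw [h.fderiv_eq_zero_of_eqOn hx (k := 0)
      fun y hy => h.gramForm_dualFrame_const hy l] at e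
    simpa using e.symm
  rw [h.eq_sum_dualFrame hx (fderiv ℝ (dualFrame η φ l) x v)]
  simp only [h1, h2, h3, neg_smul, Finset.sum_neg_distrib]
  module

/-- `∂_v √|g| = √|g| η(e^i, ∂_v e_i)`. -/
theorem fderiv_sqrt_abs_det_inducedMetric (h : IsConeSection η F c U φ) (hx : x ∈ U)
    (v : Fin m → ℝ) :
    fderiv ℝ (fun y => Real.sqrt |(inducedMetric η φ y).det|) x v =
      Real.sqrt |(inducedMetric η φ x).det| *
        ∑ i, gramForm η (dualFrame η φ i x) (fderiv ℝ (fderiv ℝ φ) x v (Pi.single i 1)) := by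
  rw [fderiv_sqrt_abs_det_apply (fun i j => (h.contDiffAt_inducedMetric hx i j).differentiableAt
    (by simp)) (h.inducedMetric_det_ne hx)]
  congr 1
  have hP : ∀ i, dualFrame η φ i x =
      ∑ j, (inducedMetric η φ x)⁻¹ i j • fderiv ℝ φ x (Pi.single j 1) :=
    fun i => (sum_smul_apply_single _ _).symm
  have hsymm : ∀ i j, (inducedMetric η φ x)⁻¹ i j = (inducedMetric η φ x)⁻¹ j i := by
    intro i j
    conv_lhs => rw [← h.inducedMetric_transpose, ← Matrix.transpose_nonsing_inv,
      Matrix.transpose_apply]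
  have hg : ∀ i j, fderiv ℝ (fun y => inducedMetric η φ y j i) x v =
      gramForm η (fderiv ℝ φ x (Pi.single i 1)) (fderiv ℝ (fderiv ℝ φ) x v (Pi.single j 1)) +
      gramForm η (fderiv ℝ φ x (Pi.single j 1))
        (fderiv ℝ (fderiv ℝ φ) x v (Pi.single i 1)) := by
    intro i j
    have hd := fun k : Fin m => (h.differentiableAt_fderiv hx).clm_apply
      (differentiableAt_const (x := x) (Pi.single k 1 : Fin m → ℝ))
    simp only [inducedMetric_apply]
    rw [fderiv_gramForm η (hd j) (hd i),
      fderiv_clm_apply (h.differentiableAt_fderiv hx) (differentiableAt_const _),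
      fderiv_clm_apply (h.differentiableAt_fderiv hx) (differentiableAt_const _)]
    simp [h.comm]
  simp only [hg, hP, mul_add, Finset.sum_add_distrib, map_sum, map_smul, sum_apply,
    smul_apply, smul_eq_mul]
  have : ∑ i, ∑ j, (inducedMetric η φ x)⁻¹ i j * gramForm η (fderiv ℝ φ x (Pi.single i 1))
      (fderiv ℝ (fderiv ℝ φ) x v (Pi.single j 1)) =
      ∑ i, ∑ j, (inducedMetric η φ x)⁻¹ i j * gramForm η (fderiv ℝ φ x (Pi.single j 1))
      (fderiv ℝ (fderiv ℝ φ) x v (Pi.single i 1)) := by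
    rw [Finset.sum_comm]
    exact Finset.sum_congr rfl fun i _ => Finset.sum_congr rfl fun j _ => by rw [hsymm]
  rw [this]
  ring

end IsConeSection

/-! ### Codifferentials of pulled-back forms -/

/-- The trace `η^{st} T(∂_s, ∂_t)` of a bilinear form. -/
noncomputable def metricTrace (η : Matrix (Fin d) (Fin d) ℝ)
    (T : (Fin d → ℝ) →L[ℝ] (Fin d → ℝ) →L[ℝ] ℝ) : ℝ :=
  ∑ s, T (Pi.single s 1) (η⁻¹ s)

/-- What has to be added to the trace of `T` over the ambient space to obtain the trace over the
tangent space of the section at `y`; its negative is the trace over the plane spanned by `y` and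
`F`, the inverse of whose Gram matrix is `[[-c, 1], [1, 0]]`. -/
noncomputable def normalTrace (c : ℝ) (y F : Fin d → ℝ)
    (T : (Fin d → ℝ) →L[ℝ] (Fin d → ℝ) →L[ℝ] ℝ) : ℝ :=
  c * T y y - T y F - T F y

/-- A field of covectors as a differential form of degree one. -/
noncomputable def oneForm (α : (Fin d → ℝ) → (Fin d → ℝ) →L[ℝ] ℝ) : DForm d 1 :=
  fun y => ContinuousAlternatingMap.ofSubsingleton ℝ _ ℝ (0 : Fin 1) (α y)

/-- The bilinear form `T(·, ·, u)`. -/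
noncomputable def evalLast (T : (Fin d → ℝ) →L[ℝ] (Fin d → ℝ) →L[ℝ] (Fin d → ℝ) →L[ℝ] ℝ)
    (u : Fin d → ℝ) : (Fin d → ℝ) →L[ℝ] (Fin d → ℝ) →L[ℝ] ℝ :=
  (ContinuousLinearMap.compL ℝ _ _ _ (ContinuousLinearMap.apply ℝ ℝ u)) ∘L T

theorem evalLast_apply (T : (Fin d → ℝ) →L[ℝ] (Fin d → ℝ) →L[ℝ] (Fin d → ℝ) →L[ℝ] ℝ)
    (u p q : Fin d → ℝ) : evalLast T u p q = T p q u := rfl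

theorem oneForm_apply (α : (Fin d → ℝ) → (Fin d → ℝ) →L[ℝ] ℝ) (y : Fin d → ℝ)
    (v : Fin 1 → Fin d → ℝ) : oneForm α y v = α y (v 0) := rfl

theorem pullback_apply_pair (φ : (Fin m → ℝ) → Fin d → ℝ) (B : DForm d 2) (y u v : Fin m → ℝ) :
    pullback φ B y ![u, v] = B (φ y) ![fderiv ℝ φ y u, fderiv ℝ φ y v] := by
  rw [pullback, ContinuousAlternatingMap.compContinuousLinearMap_apply]
  congr 1
  ext i : 1
  fin_cases i <;> rfl

namespace IsConeSection

variable {η : Matrix (Fin (m + 2)) (Fin (m + 2)) ℝ} {F : Fin (m + 2) → ℝ} {c : ℝ}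
    {U : Set (Fin m → ℝ)} {φ : (Fin m → ℝ) → Fin (m + 2) → ℝ} {x : Fin m → ℝ}

/-- The trace over the tangent space in terms of the ambient trace. -/
theorem sum_dualFrame_eq_trace (h : IsConeSection η F c U φ) (hx : x ∈ U)
    (T : (Fin (m + 2) → ℝ) →L[ℝ] (Fin (m + 2) → ℝ) →L[ℝ] ℝ) :
    ∑ k, T (fderiv ℝ φ x (Pi.single k 1)) (dualFrame η φ k x) =
      metricTrace η T + normalTrace c (φ x) F T := by
  have hs : ∀ s, T (Pi.single s 1) (η⁻¹ s) =
      ∑ k, fderiv ℝ φ x (Pi.single k 1) s * T (Pi.single s 1) (dualFrame η φ k x) +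
        (F s * T (Pi.single s 1) (φ x) - c * (φ x s * T (Pi.single s 1) (φ x))) +
        φ x s * T (Pi.single s 1) F := by
    intro s
    rw [h.eq_sum_dualFrame hx (η⁻¹ s)]
    simp only [gramForm_inv_row h.det_ne, map_add, map_sum, map_smul, smul_eq_mul]
    ring
  have hT : ∀ u w, ∑ s, u s * T (Pi.single s 1) w = T u w := by
    intro u w
    rw [← sum_smul_apply_single T u]
    simp
  simp only [metricTrace, normalTrace, hs, Finset.sum_add_distrib, Finset.sum_sub_distrib,
    ← Finset.mul_sum, hT]
  rw [Finset.sum_comm]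
  simp only [hT]
  ring

theorem differentiableAt_sqrt (h : IsConeSection η F c U φ) (hx : x ∈ U) :
    DifferentiableAt ℝ (fun y => Real.sqrt |(inducedMetric η φ y).det|) x :=
  (contDiffAt_sqrt_abs_det (r := 1) (fun i j => (h.contDiffAt_inducedMetric hx i j).of_le
    (mod_cast le_top)) (h.inducedMetric_det_ne hx)).differentiableAt one_ne_zero

/-- The divergence, with respect to the volume density `√|g|`, of the tangential part of a field of
covectors `T` along the section. The terms with `η(e^i, ∂_j e_k)` from the derivatives of `√|g|`
and of the dual frame cancel because `∂_j e_k` is symmetric, and the normal part of `∂_i e^i`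
leaves `m T(c φ - F)`. -/
theorem sum_fderiv_sqrt_mul (h : IsConeSection η F c U φ) (hx : x ∈ U)
    {T : (Fin m → ℝ) → (Fin (m + 2) → ℝ) →L[ℝ] ℝ} (hT : DifferentiableAt ℝ T x) :
    ∑ i, fderiv ℝ (fun y => Real.sqrt |(inducedMetric η φ y).det| * T y (dualFrame η φ i y)) x
        (Pi.single i 1) =
      Real.sqrt |(inducedMetric η φ x).det| *
        (m * T x (c • φ x - F) + ∑ i, fderiv ℝ T x (Pi.single i 1) (dualFrame η φ i x)) := by
  have h1 : ∀ i, fderiv ℝ (fun y => Real.sqrt |(inducedMetric η φ y).det| *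
      T y (dualFrame η φ i y)) x (Pi.single i 1) =
      Real.sqrt |(inducedMetric η φ x).det| * (T x (c • φ x - F) +
        fderiv ℝ T x (Pi.single i 1) (dualFrame η φ i x) +
        (∑ k, gramForm η (dualFrame η φ k x)
          (fderiv ℝ (fderiv ℝ φ) x (Pi.single i 1) (Pi.single k 1)) * T x (dualFrame η φ i x) -
        ∑ k, gramForm η (dualFrame η φ i x)
          (fderiv ℝ (fderiv ℝ φ) x (Pi.single i 1) (Pi.single k 1)) *
            T x (dualFrame η φ k x))) := by
    intro i
    rw [fderiv_fun_mul (h.differentiableAt_sqrt hx)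
        (hT.clm_apply (h.differentiableAt_dualFrame hx i)),
      fderiv_clm_apply hT (h.differentiableAt_dualFrame hx i)]
    simp only [add_apply, smul_apply, smul_eq_mul, ContinuousLinearMap.comp_apply,
      ContinuousLinearMap.flip_apply, h.fderiv_sqrt_abs_det_inducedMetric hx,
      h.fderiv_dualFrame hx, map_sub, map_sum, map_smul, Pi.single_eq_same, one_smul,
      ← Finset.sum_mul]
    ring
  simp only [h1, ← Finset.mul_sum, Finset.sum_add_distrib, Finset.sum_sub_distrib]
  have h2 : ∑ i, ∑ k, gramForm η (dualFrame η φ k x)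
          (fderiv ℝ (fderiv ℝ φ) x (Pi.single i 1) (Pi.single k 1)) * T x (dualFrame η φ i x) =
        ∑ i, ∑ k, gramForm η (dualFrame η φ i x)
          (fderiv ℝ (fderiv ℝ φ) x (Pi.single i 1) (Pi.single k 1)) *
            T x (dualFrame η φ k x) := by
    rw [Finset.sum_comm]
    refine Finset.sum_congr rfl fun i _ => Finset.sum_congr rfl fun k _ => ?_
    rw [h.fderiv_fderiv_comm hx]
  rw [h2, sub_self, add_zero]
  simp only [Finset.sum_const, Finset.card_univ, Fintype.card_fin, nsmul_eq_mul]

/-- The codifferential of a pulled-back one-form is the restriction of a function on the ambient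
space: `δ_Σ (φ^* α) = -φ^* (div α + m α(c y - F) + normal part of ∇α)`. -/
theorem codiff_pullback_oneForm (h : IsConeSection η F c U φ) (hm : 1 ≤ m) (hx : x ∈ U)
    {α : (Fin (m + 2) → ℝ) → (Fin (m + 2) → ℝ) →L[ℝ] ℝ} (hα : DifferentiableAt ℝ α (φ x))
    (v : Fin 0 → Fin m → ℝ) :
    codiff (inducedMetric η φ) (pullback φ (oneForm α)) x v =
      -(metricTrace η (fderiv ℝ α (φ x)) + (m * α (φ x) (c • φ x - F) +
        normalTrace c (φ x) F (fderiv ℝ α (φ x)))) := by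
  have hT : DifferentiableAt ℝ (fun y => α (φ y)) x := hα.comp x (h.differentiableAt hx)
  have hsq : Real.sqrt |(inducedMetric η φ x).det| ≠ 0 :=
    (Real.sqrt_pos.mpr (abs_pos.mpr (h.inducedMetric_det_ne hx))).ne'
  have key := h.sum_fderiv_sqrt_mul hx hT
  have hd : fderiv ℝ (fun y => α (φ y)) x = (fderiv ℝ α (φ x)).comp (fderiv ℝ φ x) :=
    fderiv_comp x hα (h.differentiableAt hx)
  simp only [hd, ContinuousLinearMap.comp_apply] at key
  rw [h.sum_dualFrame_eq_trace hx] at key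
  rw [codiff_one_apply hm _ _ (h.inducedMetric_det_ne hx) fun s =>
    (h.differentiableAt_sqrt hx).mul (hT.clm_apply (h.differentiableAt_dualFrame hx s))]
  refine congrArg Neg.neg (Eq.trans (congrArg _ key) ?_)
  field_simp
  ring

/-- The codifferential of a pulled-back two-form is the pullback of a one-form on the ambient space.
Compared with the degree-one case, the derivative of the second dual frame vector contributes
`-β(c y - F, ·)`, which turns the factor `m` into `m - 1`. -/
theorem codiff_pullback_two (h : IsConeSection η F c U φ) (hx : x ∈ U)
    {B : DForm (m + 2) 2}
    {β : (Fin (m + 2) → ℝ) → (Fin (m + 2) → ℝ) →L[ℝ] (Fin (m + 2) → ℝ) →L[ℝ] ℝ}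
    (hB : ∀ y u v, B y ![u, v] = β y u v) (hβ : DifferentiableAt ℝ β (φ x))
    (v : Fin 1 → Fin m → ℝ) :
    codiff (inducedMetric η φ) (pullback φ B) x v =
      -(metricTrace η (evalLast (fderiv ℝ β (φ x)) (fderiv ℝ φ x (v 0))) +
        (((m : ℝ) - 1) * β (φ x) (c • φ x - F) (fderiv ℝ φ x (v 0)) +
        normalTrace c (φ x) F (evalLast (fderiv ℝ β (φ x)) (fderiv ℝ φ x (v 0))))) := by
  have hanti : ∀ y u v, β y v u = -β y u v := by
    intro y u v
    rw [← hB, ← hB, apply_swap]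
  have hsq : Real.sqrt |(inducedMetric η φ x).det| ≠ 0 :=
    (Real.sqrt_pos.mpr (abs_pos.mpr (h.inducedMetric_det_ne hx))).ne'
  have hβφ : DifferentiableAt ℝ (fun y => β (φ y)) x :=
    DifferentiableAt.comp (G := (Fin (m + 2) → ℝ) →L[ℝ] (Fin (m + 2) → ℝ) →L[ℝ] ℝ) x hβ
      (h.differentiableAt hx)
  have hd : fderiv ℝ (fun y => β (φ y)) x = (fderiv ℝ β (φ x)).comp (fderiv ℝ φ x) :=
    fderiv_comp (G := (Fin (m + 2) → ℝ) →L[ℝ] (Fin (m + 2) → ℝ) →L[ℝ] ℝ) x hβ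
      (h.differentiableAt hx)
  have hβ2 : ∀ w u v, fderiv ℝ β (φ x) w u v = fderiv ℝ (fun y => β y u v) (φ x) w := by
    intro w u v
    have := (hβ.hasFDerivAt.clm_apply (hasFDerivAt_const u (φ x))).clm_apply
      (hasFDerivAt_const v (φ x))
    rw [this.fderiv]
    simp
  have hanti' : ∀ w u v, fderiv ℝ β (φ x) w v u = -fderiv ℝ β (φ x) w u v := by
    intro w u v
    rw [hβ2, hβ2, funext fun y => hanti y u v, fderiv_fun_neg, neg_apply]
  -- contraction with a dual frame vector in the second slot
  let T : Fin m → (Fin m → ℝ) → (Fin (m + 2) → ℝ) →L[ℝ] ℝ :=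
    fun j y => -(β (φ y) (dualFrame η φ j y))
  have hT : ∀ j, DifferentiableAt ℝ (T j) x :=
    fun j => (hβφ.clm_apply (h.differentiableAt_dualFrame hx j)).neg
  have hBT : ∀ i j y, pullback φ B y ![(inducedMetric η φ y)⁻¹ i, (inducedMetric η φ y)⁻¹ j] =
      T j y (dualFrame η φ i y) := by
    intro i j y
    rw [pullback_apply_pair, hB, hanti]
    rfl
  let L : (Fin m → ℝ) →L[ℝ] ℝ :=
    (((m : ℝ) - 1) • β (φ x) (c • φ x - F) + ∑ i, fderiv ℝ β (φ x)
      (fderiv ℝ φ x (Pi.single i 1)) (dualFrame η φ i x)) ∘L fderiv ℝ φ x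
  have hW : ∀ j, ∑ i, fderiv ℝ (fun y => Real.sqrt |(inducedMetric η φ y).det| *
      T j y (dualFrame η φ i y)) x (Pi.single i 1) =
      (Real.sqrt |(inducedMetric η φ x).det| • L) ((inducedMetric η φ x)⁻¹ j) := by
    intro j
    rw [h.sum_fderiv_sqrt_mul hx (hT j)]
    have hdT : ∀ i, fderiv ℝ (T j) x (Pi.single i 1) (dualFrame η φ i x) =
        fderiv ℝ β (φ x) (fderiv ℝ φ x (Pi.single i 1)) (dualFrame η φ i x)
          (dualFrame η φ j x) + β (φ x) (dualFrame η φ i x)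
            (fderiv ℝ (dualFrame η φ j) x (Pi.single i 1)) := by
      intro i
      have e : fderiv ℝ (T j) x = -((β (φ x)).comp (fderiv ℝ (dualFrame η φ j) x) +
          ((fderiv ℝ β (φ x)).comp (fderiv ℝ φ x)).flip (dualFrame η φ j x)) := by
        rw [← hd, ← fderiv_clm_apply hβφ (h.differentiableAt_dualFrame hx j)]
        exact fderiv_fun_neg
      rw [e]
      simp only [neg_apply, add_apply, ContinuousLinearMap.comp_apply,
        ContinuousLinearMap.flip_apply]
      rw [hanti' _ (dualFrame η φ i x), hanti _ (dualFrame η φ i x)]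
      ring
    -- `∂_i e_k` is symmetric and `β` is antisymmetric in `i`, `k`
    have hskew : ∑ i, ∑ k, gramForm η (dualFrame η φ j x)
        (fderiv ℝ (fderiv ℝ φ) x (Pi.single i 1) (Pi.single k 1)) *
          β (φ x) (dualFrame η φ i x) (dualFrame η φ k x) = 0 := by
      rw [← self_eq_neg]
      conv_lhs => rw [Finset.sum_comm]
      simp only [← Finset.sum_neg_distrib]
      refine Finset.sum_congr rfl fun i _ => Finset.sum_congr rfl fun k _ => ?_
      rw [h.fderiv_fderiv_comm hx, hanti]
      ring
    have hν : ∑ i, β (φ x) (dualFrame η φ i x)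
        (fderiv ℝ (dualFrame η φ j) x (Pi.single i 1)) =
          -β (φ x) (c • φ x - F) (dualFrame η φ j x) := by
      simp only [h.fderiv_dualFrame hx, map_sub (β (φ x) (dualFrame η φ _ x)), map_sum, map_smul,
        smul_eq_mul, Finset.sum_sub_distrib, hskew, sub_zero]
      rw [Finset.sum_eq_single j]
      · rw [Pi.single_eq_same, one_mul, ← hanti, map_sub, map_smul, smul_eq_mul]
      · intro i _ hi
        rw [Pi.single_eq_of_ne hi.symm, zero_mul]
      · simp
    simp only [hdT, Finset.sum_add_distrib, hν]
    simp only [L, T, smul_apply, add_apply, sum_apply, neg_apply, smul_eq_mul,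
      ContinuousLinearMap.comp_apply]
    rw [hanti _ (c • φ x - F)]
    simp only [← dualFrame.eq_def]
    ring
  rw [codiff_two_apply _ _ (h.inducedMetric_det_ne hx) fun i j => by
    simp only [hBT]
    exact (h.differentiableAt_sqrt hx).mul
      ((hT j).clm_apply (h.differentiableAt_dualFrame hx i))]
  simp only [hBT, hW]
  rw [vecMul_inv_dotProduct _ (h.inducedMetric_det_ne hx) (h.inducedMetric_transpose x)]
  have htr := h.sum_dualFrame_eq_trace hx (evalLast (fderiv ℝ β (φ x)) (fderiv ℝ φ x (v 0)))
  simp only [smul_apply, smul_eq_mul, inv_mul_cancel_left₀ hsq]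
  rw [← sub_eq_zero]
  simp only [L, ContinuousLinearMap.comp_apply, add_apply, smul_apply, sum_apply, smul_eq_mul]
  simp only [evalLast_apply] at htr
  linarith

end IsConeSection

/-! ### The Laplace–de Rham operator of a pulled-back one-form -/

/-- The exterior derivative of the one-form `α` as a bilinear form. -/
noncomputable def curl (α : (Fin d → ℝ) → (Fin d → ℝ) →L[ℝ] ℝ) (y : Fin d → ℝ) :
    (Fin d → ℝ) →L[ℝ] (Fin d → ℝ) →L[ℝ] ℝ :=
  fderiv ℝ α y - (fderiv ℝ α y).flip

theorem differentiableAt_oneForm {α : (Fin d → ℝ) → (Fin d → ℝ) →L[ℝ] ℝ} {y : Fin d → ℝ}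
    (hα : DifferentiableAt ℝ α y) : DifferentiableAt ℝ (oneForm α) y :=
  (ContinuousAlternatingMap.ofSubsingletonLIE (𝕜 := ℝ) (E := Fin d → ℝ) (F := ℝ)
    (0 : Fin 1)).differentiable.differentiableAt.comp y hα

theorem fderiv_oneForm_apply {α : (Fin d → ℝ) → (Fin d → ℝ) →L[ℝ] ℝ} {y : Fin d → ℝ}
    (hα : DifferentiableAt ℝ α y) (u : Fin d → ℝ) (v : Fin 1 → Fin d → ℝ) :
    fderiv ℝ (oneForm α) y u v = fderiv ℝ α y u (v 0) := by
  have : HasFDerivAt (oneForm α) _ y :=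
    (ContinuousAlternatingMap.ofSubsingletonLIE (𝕜 := ℝ) (E := Fin d → ℝ) (F := ℝ)
      (0 : Fin 1)).toContinuousLinearEquiv.hasFDerivAt.comp y hα.hasFDerivAt
  rw [this.fderiv]
  rfl

theorem extDeriv_oneForm_apply {α : (Fin d → ℝ) → (Fin d → ℝ) →L[ℝ] ℝ} {y : Fin d → ℝ}
    (hα : DifferentiableAt ℝ α y) (u v : Fin d → ℝ) :
    extDeriv (oneForm α) y ![u, v] = curl α y u v := by
  rw [extDeriv, ContinuousAlternatingMap.alternatizeUncurryFin_apply, Fin.sum_univ_two]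
  simp [fderiv_oneForm_apply hα, curl, Fin.removeNth, sub_eq_add_neg]

theorem hasFDerivAt_clm_comp {G V W : Type*} [NormedAddCommGroup V] [NormedSpace ℝ V]
    [NormedAddCommGroup G] [NormedSpace ℝ G] [NormedAddCommGroup W] [NormedSpace ℝ W]
    (Φ : V →L[ℝ] W) {A : G → V} {y : G} (hA : DifferentiableAt ℝ A y) :
    HasFDerivAt (fun z => Φ (A z)) (Φ ∘L fderiv ℝ A y) y :=
  Φ.hasFDerivAt.comp y hA.hasFDerivAt

theorem fderiv_flip_apply {E G : Type*} [NormedAddCommGroup E] [NormedSpace ℝ E]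
    [NormedAddCommGroup G] [NormedSpace ℝ G] {A : G → E →L[ℝ] E →L[ℝ] ℝ} {y : G}
    (hA : DifferentiableAt ℝ A y) : DifferentiableAt ℝ (fun z => (A z).flip) y ∧
    ∀ w u v, fderiv ℝ (fun z => (A z).flip) y w u v = fderiv ℝ A y w v u := by
  let Φ : (E →L[ℝ] E →L[ℝ] ℝ) →L[ℝ] (E →L[ℝ] E →L[ℝ] ℝ) :=
    (ContinuousLinearMap.flipₗᵢ ℝ E E ℝ).toContinuousLinearEquiv.toContinuousLinearMap
  have h := hasFDerivAt_clm_comp (V := E →L[ℝ] E →L[ℝ] ℝ) (W := E →L[ℝ] E →L[ℝ] ℝ) Φ hA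
  exact ⟨h.differentiableAt, fun w u v => by erw [h.fderiv]; rfl⟩

theorem fderiv_curl_apply {α : (Fin d → ℝ) → (Fin d → ℝ) →L[ℝ] ℝ} {y : Fin d → ℝ}
    (hα : DifferentiableAt ℝ (fderiv ℝ α) y) (w u v : Fin d → ℝ) :
    DifferentiableAt ℝ (curl α) y ∧ fderiv ℝ (curl α) y w u v =
      fderiv ℝ (fderiv ℝ α) y w u v - fderiv ℝ (fderiv ℝ α) y w v u := by
  obtain ⟨h1, h3⟩ := fderiv_flip_apply hα
  have h2 := HasFDerivAt.fun_sub (𝕜 := ℝ) (E := Fin d → ℝ)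
    (F := (Fin d → ℝ) →L[ℝ] (Fin d → ℝ) →L[ℝ] ℝ) (f' := fderiv ℝ (fderiv ℝ α) y)
    (g' := fderiv ℝ (fun z => (fderiv ℝ α z).flip) y) hα.hasFDerivAt h1.hasFDerivAt
  refine ⟨h2.differentiableAt, ?_⟩
  rw [show fderiv ℝ (curl α) y = _ from h2.fderiv, ← h3 w u v]
  rfl

theorem codiff_const_oneForm (hd : 1 ≤ d) {η : Matrix (Fin d) (Fin d) ℝ} (hη : η.det ≠ 0)
    {α : (Fin d → ℝ) → (Fin d → ℝ) →L[ℝ] ℝ} {y : Fin d → ℝ} (hα : DifferentiableAt ℝ α y)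
    (v : Fin 0 → Fin d → ℝ) :
    codiff (fun _ => η) (oneForm α) y v = -metricTrace η (fderiv ℝ α y) := by
  have hsq : Real.sqrt |η.det| ≠ 0 := (Real.sqrt_pos.mpr (abs_pos.mpr hη)).ne'
  have h1 : ∀ s, HasFDerivAt (fun z => Real.sqrt |η.det| * oneForm α z fun _ => η⁻¹ s)
      (Real.sqrt |η.det| • (fderiv ℝ α y).flip (η⁻¹ s)) y := by
    intro s
    simp only [oneForm_apply]
    have := (hα.hasFDerivAt.clm_apply (hasFDerivAt_const (η⁻¹ s) y)).const_mul
      (Real.sqrt |η.det|)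
    simpa using this
  rw [codiff_one_apply hd _ _ hη fun s => (h1 s).differentiableAt]
  simp only [(h1 _).fderiv, metricTrace, smul_apply, ContinuousLinearMap.flip_apply, smul_eq_mul,
    ← Finset.mul_sum, inv_mul_cancel_left₀ hsq]

theorem codiff_const_two {η : Matrix (Fin d) (Fin d) ℝ} (hη : η.det ≠ 0) (hs : ηᵀ = η)
    {B : DForm d 2} {β : (Fin d → ℝ) → (Fin d → ℝ) →L[ℝ] (Fin d → ℝ) →L[ℝ] ℝ}
    (hB : ∀ y u v, B y ![u, v] = β y u v) {y : Fin d → ℝ} (hβ : DifferentiableAt ℝ β y)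
    (v : Fin 1 → Fin d → ℝ) :
    codiff (fun _ => η) B y v = -metricTrace η (evalLast (fderiv ℝ β y) (v 0)) := by
  have hsq : Real.sqrt |η.det| ≠ 0 := (Real.sqrt_pos.mpr (abs_pos.mpr hη)).ne'
  have h1 : ∀ i j, HasFDerivAt (fun z => Real.sqrt |η.det| * B z ![η⁻¹ i, η⁻¹ j])
      (Real.sqrt |η.det| • ((fderiv ℝ β y).flip (η⁻¹ i)).flip (η⁻¹ j)) y := by
    intro i j
    simp only [hB]
    have := ((hβ.hasFDerivAt.clm_apply (hasFDerivAt_const (η⁻¹ i) y)).clm_apply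
      (hasFDerivAt_const (η⁻¹ j) y)).const_mul (Real.sqrt |η.det|)
    simpa using this
  rw [codiff_two_apply _ _ hη fun i j => (h1 i j).differentiableAt]
  have h2 : ∀ j, ∑ i, fderiv ℝ (fun z => Real.sqrt |η.det| * B z ![η⁻¹ i, η⁻¹ j]) y
      (Pi.single i 1) = (Real.sqrt |η.det| •
        ∑ i, fderiv ℝ β y (Pi.single i 1) (η⁻¹ i)) (η⁻¹ j) := by
    intro j
    simp [(h1 _ _).fderiv, Finset.mul_sum]
  simp only [h2]
  rw [vecMul_inv_dotProduct _ hη hs]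
  simp [metricTrace, evalLast_apply, inv_mul_cancel_left₀ hsq]

/-- The codifferential at a point depends only on the germ of the form. -/
theorem codiff_congr {p : ℕ} {g : Metric d} {B B' : DForm d (p + 1)} {x : Fin d → ℝ}
    (hB : B =ᶠ[nhds x] B') : codiff g B x = codiff g B' x := by
  unfold codiff
  split_ifs with h
  · have : (fun y => hodge (q := d - (p + 1)) (g y) (by omega) (B y)) =ᶠ[nhds x]
        fun y => hodge (q := d - (p + 1)) (g y) (by omega) (B' y) :=
      hB.mono fun y hy => by simp only [hy]
    simp only [this.extDeriv_eq]
  · rfl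

/-- The exterior derivative of a zero-form given near `x` by a function `s` is `ds`. -/
theorem extDeriv_zeroForm_apply {τ : DForm d 0} {s : (Fin d → ℝ) → ℝ} {x : Fin d → ℝ}
    (hτ : ∀ᶠ y in nhds x, ∀ v, τ y v = s y) (v : Fin 1 → Fin d → ℝ) :
    extDeriv τ x v = fderiv ℝ s x (v 0) := by
  have : τ =ᶠ[nhds x] fun y => ContinuousAlternatingMap.constOfIsEmpty ℝ _ (Fin 0) (s y) :=
    hτ.mono fun y hy => by
      ext v
      simp [hy v]
  rw [this.extDeriv_eq, extDeriv_constOfIsEmpty]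
  rfl

/-- The function by which the divergence of `φ^* α` differs from the restriction of the ambient
divergence of `α`. -/
noncomputable def normalDiv (n : ℕ) (c : ℝ) (F : Fin d → ℝ)
    (α : (Fin d → ℝ) → (Fin d → ℝ) →L[ℝ] ℝ) (y : Fin d → ℝ) : ℝ :=
  n * α y (c • y - F) + normalTrace c y F (fderiv ℝ α y)

theorem fderiv_normalDiv_apply (n : ℕ) (c : ℝ) (F : Fin d → ℝ)
    {α : (Fin d → ℝ) → (Fin d → ℝ) →L[ℝ] ℝ} {y : Fin d → ℝ} (hα : DifferentiableAt ℝ α y)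
    (hα' : DifferentiableAt ℝ (fderiv ℝ α) y) (u : Fin d → ℝ) :
    DifferentiableAt ℝ (normalDiv n c F α) y ∧ fderiv ℝ (normalDiv n c F α) y u =
      n * (fderiv ℝ α y u (c • y - F) + c * α y u) +
      normalTrace c y F (fderiv ℝ (fderiv ℝ α) y u) + c * (fderiv ℝ α y u y + fderiv ℝ α y y u)
        - fderiv ℝ α y u F - fderiv ℝ α y F u := by
  have hid := hasFDerivAt_id (𝕜 := ℝ) y
  have hF := hasFDerivAt_const (𝕜 := ℝ) F y
  have hp : HasFDerivAt (normalDiv n c F α) _ y :=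
    ((hα.hasFDerivAt.clm_apply ((hid.const_smul c).sub hF)).const_mul (n : ℝ)).add
      (((((hα'.hasFDerivAt.clm_apply hid).clm_apply hid).const_mul c).sub
        ((hα'.hasFDerivAt.clm_apply hid).clm_apply hF)).sub
          ((hα'.hasFDerivAt.clm_apply hF).clm_apply hid))
  refine ⟨hp.differentiableAt, ?_⟩
  rw [hp.fderiv]
  simp [normalTrace]
  ring

theorem differentiable_metricTrace (η : Matrix (Fin d) (Fin d) ℝ)
    {T : (Fin d → ℝ) → (Fin d → ℝ) →L[ℝ] (Fin d → ℝ) →L[ℝ] ℝ} {y : Fin d → ℝ}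
    (hT : DifferentiableAt ℝ T y) : DifferentiableAt ℝ (fun z => metricTrace η (T z)) y := by
  unfold metricTrace
  exact DifferentiableAt.fun_sum fun s _ =>
    (hT.clm_apply (differentiableAt_const _)).clm_apply (differentiableAt_const _)

/-- The restriction formula before the correction terms are expressed through Lie derivatives: the
ambient divergences cancel, and the normal parts of the two codifferentials remain. -/
theorem IsConeSection.pullback_laplaceDeRham_apply
    {η : Matrix (Fin (m + 2)) (Fin (m + 2)) ℝ} {F : Fin (m + 2) → ℝ} {c : ℝ}
    {U : Set (Fin m → ℝ)} {φ : (Fin m → ℝ) → Fin (m + 2) → ℝ} {x : Fin m → ℝ}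
    (h : IsConeSection η F c U φ) (hm : 1 ≤ m) (hx : x ∈ U)
    {α : (Fin (m + 2) → ℝ) → (Fin (m + 2) → ℝ) →L[ℝ] ℝ} (hα : ContDiff ℝ ∞ α)
    (v : Fin 1 → Fin m → ℝ) :
    pullback φ (laplaceDeRham (fun _ => η) (oneForm α)) x v =
      laplaceDeRham (inducedMetric η φ) (pullback φ (oneForm α)) x v -
      (fderiv ℝ (normalDiv m c F α) (φ x) (fderiv ℝ φ x (v 0)) +
        (((m : ℝ) - 1) * curl α (φ x) (c • φ x - F) (fderiv ℝ φ x (v 0)) +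
        normalTrace c (φ x) F (evalLast (fderiv ℝ (curl α) (φ x)) (fderiv ℝ φ x (v 0))))) := by
  have hd : Differentiable ℝ α := hα.differentiable (by simp)
  have hd' : Differentiable ℝ (fderiv ℝ α) :=
    (hα.fderiv_right (m := ∞) (by simp)).differentiable (by simp)
  have hU : ∀ᶠ y in nhds x, y ∈ U := h.isOpen.mem_nhds hx
  have hcurl : ∀ y u v, extDeriv (oneForm α) y ![u, v] = curl α y u v :=
    fun y => extDeriv_oneForm_apply (hd y)
  have hcd : ∀ y, DifferentiableAt ℝ (curl α) y := fun y => (fderiv_curl_apply (hd' y) 0 0 0).1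
  have hpull : extDeriv (pullback φ (oneForm α)) =ᶠ[nhds x]
      pullback φ (extDeriv (oneForm α)) := by
    filter_upwards [hU] with y hy
    exact extDeriv_pullback (differentiableAt_oneForm (hd _)) (h.contDiffAt hy)
      (by simpa using (mod_cast le_top : ((2 : ℕ∞) : ℕ∞ω) ≤ ∞))
  set S : (Fin (m + 2) → ℝ) → ℝ := fun y => metricTrace η (fderiv ℝ α y)
  have hS : DifferentiableAt ℝ S (φ x) := differentiable_metricTrace η (hd' _)
  have hN := (fderiv_normalDiv_apply m c F (hd (φ x)) (hd' (φ x)) 0).1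
  have e1 : ∀ w, extDeriv (codiff (fun _ => η) (oneForm α)) (φ x) w =
      -fderiv ℝ S (φ x) (w 0) := by
    intro w
    rw [extDeriv_zeroForm_apply (s := fun y => -S y)
      (Filter.Eventually.of_forall fun y v => codiff_const_oneForm (by omega) h.det_ne (hd y) v)]
    rw [fderiv_fun_neg, neg_apply]
  have e2 : extDeriv (codiff (inducedMetric η φ) (pullback φ (oneForm α))) x v =
      -(fderiv ℝ S (φ x) (fderiv ℝ φ x (v 0)) +
        fderiv ℝ (normalDiv m c F α) (φ x) (fderiv ℝ φ x (v 0))) := by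
    rw [extDeriv_zeroForm_apply (s := fun y => -(S (φ y) + normalDiv m c F α (φ y)))]
    · have := ((hS.hasFDerivAt.add hN.hasFDerivAt).comp x
        (h.differentiableAt hx).hasFDerivAt).neg
      rw [show fderiv ℝ (fun y => -(S (φ y) + normalDiv m c F α (φ y))) x = _ from this.fderiv]
      rfl
    · filter_upwards [hU] with y hy
      exact h.codiff_pullback_oneForm hm hy (hd _)
  have e3 := codiff_const_two h.det_ne h.transpose_eq hcurl (hcd (φ x))
    (fderiv ℝ φ x ∘ v)
  have e4 := h.codiff_pullback_two hx hcurl (hcd (φ x)) v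
  rw [← codiff_congr hpull] at e4
  have lhs : pullback φ (laplaceDeRham (fun _ => η) (oneForm α)) x v =
      -(extDeriv (codiff (fun _ => η) (oneForm α)) (φ x) (fderiv ℝ φ x ∘ v) +
        codiff (fun _ => η) (extDeriv (oneForm α)) (φ x) (fderiv ℝ φ x ∘ v)) := rfl
  have rhs : laplaceDeRham (inducedMetric η φ) (pullback φ (oneForm α)) x v =
      -(extDeriv (codiff (inducedMetric η φ) (pullback φ (oneForm α))) x v +
        codiff (inducedMetric η φ) (extDeriv (pullback φ (oneForm α))) x v) := rfl
  rw [lhs, rhs, e1, e2, e3, e4]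
  simp only [Function.comp_apply]
  ring

/-! ### Lie derivatives along the dilation and along constant fields -/

/-- `d i_X α` for a vector field `X` with constant derivative `s • id`. -/
theorem extDeriv_interiorProd_oneForm {X : (Fin d → ℝ) → Fin d → ℝ} {s : ℝ}
    (hX : ∀ y, HasFDerivAt X (s • ContinuousLinearMap.id ℝ (Fin d → ℝ)) y)
    {α : (Fin d → ℝ) → (Fin d → ℝ) →L[ℝ] ℝ} (hα : Differentiable ℝ α) :
    extDeriv (interiorProd X (oneForm α)) =
      oneForm fun y => (fderiv ℝ α y).flip (X y) + s • α y := by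
  ext y v
  rw [extDeriv_zeroForm_apply (s := fun y => α y (X y))
      (Filter.Eventually.of_forall fun y v => rfl),
    ((hα y).hasFDerivAt.clm_apply (hX y)).fderiv, oneForm_apply]
  simp [add_comm]

/-- `L_X α = ∂_X α + s α` for a vector field `X` with constant derivative `s • id`. -/
theorem lieDeriv_oneForm {X : (Fin d → ℝ) → Fin d → ℝ} {s : ℝ}
    (hX : ∀ y, HasFDerivAt X (s • ContinuousLinearMap.id ℝ (Fin d → ℝ)) y)
    {α : (Fin d → ℝ) → (Fin d → ℝ) →L[ℝ] ℝ} (hα : Differentiable ℝ α) :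
    lieDeriv X (oneForm α) = oneForm fun y => fderiv ℝ α y (X y) + s • α y := by
  rw [lieDeriv, extDeriv_interiorProd_oneForm hX hα]
  ext y v
  have : interiorProd X (extDeriv (oneForm α)) y v = curl α y (X y) (v 0) := by
    rw [← extDeriv_oneForm_apply (hα y), interiorProd,
      ContinuousAlternatingMap.curryLeft_apply_apply]
    congr 1
    ext i : 1
    fin_cases i <;> rfl
  rw [Pi.add_apply, ContinuousAlternatingMap.add_apply, this, oneForm_apply, oneForm_apply]
  simp [curl]
  ring

theorem exists_oneForm_eq {a : DForm d 1} (ha : ContDiff ℝ ∞ a) :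
    ∃ α : (Fin d → ℝ) → (Fin d → ℝ) →L[ℝ] ℝ, ContDiff ℝ ∞ α ∧ oneForm α = a := by
  let Φ := ContinuousAlternatingMap.ofSubsingletonLIE (𝕜 := ℝ) (E := Fin d → ℝ) (F := ℝ)
    (0 : Fin 1)
  refine ⟨fun y => Φ.symm (a y), Φ.symm.contDiff.comp ha, ?_⟩
  ext1 y
  exact Φ.apply_symm_apply (a y)

theorem hasFDerivAt_dilation (y : Fin d → ℝ) :
    HasFDerivAt (dilation d) ((1 : ℝ) • ContinuousLinearMap.id ℝ (Fin d → ℝ)) y := by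
  rw [one_smul]
  exact hasFDerivAt_id y

theorem hasFDerivAt_const_field (F y : Fin d → ℝ) :
    HasFDerivAt (fun _ : Fin d → ℝ => F) ((0 : ℝ) • ContinuousLinearMap.id ℝ (Fin d → ℝ)) y := by
  rw [zero_smul]
  exact hasFDerivAt_const F y

theorem fderiv_lieDeriv_coeff {X : (Fin d → ℝ) → Fin d → ℝ} {s : ℝ}
    (hX : ∀ y, HasFDerivAt X (s • ContinuousLinearMap.id ℝ (Fin d → ℝ)) y)
    {α : (Fin d → ℝ) → (Fin d → ℝ) →L[ℝ] ℝ} (hα : Differentiable ℝ α)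
    (hα' : Differentiable ℝ (fderiv ℝ α)) :
    Differentiable ℝ (fun y => fderiv ℝ α y (X y) + s • α y) ∧ ∀ y w u,
      fderiv ℝ (fun y => fderiv ℝ α y (X y) + s • α y) y w u =
        fderiv ℝ (fderiv ℝ α) y w (X y) u + 2 * s * fderiv ℝ α y w u := by
  have h := fun y => ((hα' y).hasFDerivAt.clm_apply (hX y)).add ((hα y).hasFDerivAt.const_smul s)
  refine ⟨fun y => (h y).differentiableAt, fun y w u => ?_⟩
  rw [show fderiv ℝ (fun y => fderiv ℝ α y (X y) + s • α y) y = _ from (h y).fderiv]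
  simp
  ring

/-- The normal parts of the two codifferentials, expressed through Lie derivatives along the
dilation and along `F`; an identity on the ambient space, valid at every point. -/
theorem normal_terms_eq (n : ℕ) (c : ℝ) (F : Fin d → ℝ)
    {α : (Fin d → ℝ) → (Fin d → ℝ) →L[ℝ] ℝ} (hα : ContDiff ℝ ∞ α) (y u : Fin d → ℝ) :
    -(fderiv ℝ (normalDiv n c F α) y u +
        (((n : ℝ) - 1) * curl α y (c • y - F) u +
        normalTrace c y F (evalLast (fderiv ℝ (curl α) y) u))) =
      (-c • (lieDeriv (dilation d) (lieDeriv (dilation d) (oneForm α))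
            + ((n : ℝ) - 3) • lieDeriv (dilation d) (oneForm α)
            + (2 : ℝ) • extDeriv (interiorProd (dilation d) (oneForm α)))
          + (2 : ℝ) • lieDeriv (fun _ => F) (lieDeriv (dilation d) (oneForm α))
          + ((n : ℝ) - 4) • lieDeriv (fun _ => F) (oneForm α)
          + (2 : ℝ) • extDeriv (interiorProd (fun _ => F) (oneForm α))) y (fun _ => u) := by
  have hd : Differentiable ℝ α := hα.differentiable (by simp)
  have hd' : Differentiable ℝ (fderiv ℝ α) :=
    (hα.fderiv_right (m := ∞) (by simp)).differentiable (by simp)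
  have hD := hasFDerivAt_dilation (d := d)
  have hF := hasFDerivAt_const_field F
  obtain ⟨hlD, hlD'⟩ := fderiv_lieDeriv_coeff hD hd hd'
  have hsymm : ∀ v w, fderiv ℝ (fderiv ℝ α) y v w = fderiv ℝ (fderiv ℝ α) y w v :=
    hα.contDiffAt.isSymmSndFDerivAt (by simpa using (mod_cast le_top : ((2 : ℕ∞) : ℕ∞ω) ≤ ∞))
  rw [extDeriv_interiorProd_oneForm hD hd, extDeriv_interiorProd_oneForm hF hd,
    lieDeriv_oneForm hD hd, lieDeriv_oneForm hF hd, lieDeriv_oneForm hD hlD,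
    lieDeriv_oneForm hF hlD, (fderiv_normalDiv_apply n c F (hd y) (hd' y) u).2]
  simp only [normalTrace, evalLast_apply, (fderiv_curl_apply (hd' y) _ _ _).2, Pi.add_apply,
    Pi.smul_apply, ContinuousAlternatingMap.add_apply, ContinuousAlternatingMap.smul_apply,
    oneForm_apply, add_apply, smul_apply, smul_eq_mul, ContinuousLinearMap.flip_apply, hlD']
  simp only [dilation, curl, sub_apply, map_sub, map_smul, smul_apply, smul_eq_mul,
    ContinuousLinearMap.flip_apply, hsymm u, hsymm F y]
  ring

/-- `L_F L_D = L_D L_F + L_F`, as `[F, D] = F`. -/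
theorem lieDeriv_comm (F : Fin d → ℝ)
    {α : (Fin d → ℝ) → (Fin d → ℝ) →L[ℝ] ℝ} (hα : ContDiff ℝ ∞ α) :
    lieDeriv (fun _ => F) (lieDeriv (dilation d) (oneForm α)) =
      lieDeriv (dilation d) (lieDeriv (fun _ => F) (oneForm α)) +
        lieDeriv (fun _ => F) (oneForm α) := by
  have hd : Differentiable ℝ α := hα.differentiable (by simp)
  have hd' : Differentiable ℝ (fderiv ℝ α) :=
    (hα.fderiv_right (m := ∞) (by simp)).differentiable (by simp)
  have hD := hasFDerivAt_dilation (d := d)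
  have hF := hasFDerivAt_const_field F
  obtain ⟨hlD, hlD'⟩ := fderiv_lieDeriv_coeff hD hd hd'
  obtain ⟨hlF, hlF'⟩ := fderiv_lieDeriv_coeff hF hd hd'
  rw [lieDeriv_oneForm hD hd, lieDeriv_oneForm hF hd, lieDeriv_oneForm hD hlF,
    lieDeriv_oneForm hF hlD]
  ext y v
  have hsymm : ∀ v w, fderiv ℝ (fderiv ℝ α) y v w = fderiv ℝ (fderiv ℝ α) y w v :=
    hα.contDiffAt.isSymmSndFDerivAt (by simpa using (mod_cast le_top : ((2 : ℕ∞) : ℕ∞ω) ≤ ∞))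
  simp only [Pi.add_apply, ContinuousAlternatingMap.add_apply, oneForm_apply, add_apply,
    smul_apply, smul_eq_mul, hlD', hlF']
  rw [hsymm F]
  simp only [dilation]
  ring

/-- The restriction formula for any nondegenerate symmetric form `η`, without a condition on
`c = η(F, F)`. -/
theorem IsConeSection.pullback_laplaceDeRham
    {η : Matrix (Fin (m + 2)) (Fin (m + 2)) ℝ} {F : Fin (m + 2) → ℝ} {c : ℝ}
    {U : Set (Fin m → ℝ)} {φ : (Fin m → ℝ) → Fin (m + 2) → ℝ} {x : Fin m → ℝ}
    (h : IsConeSection η F c U φ) (hm : 1 ≤ m) (hx : x ∈ U)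
    {α : (Fin (m + 2) → ℝ) → (Fin (m + 2) → ℝ) →L[ℝ] ℝ} (hα : ContDiff ℝ ∞ α) :
    pullback φ (laplaceDeRham (fun _ => η) (oneForm α)) x =
      laplaceDeRham (inducedMetric η φ) (pullback φ (oneForm α)) x +
      pullback φ
        (-c • (lieDeriv (dilation _) (lieDeriv (dilation _) (oneForm α))
              + ((m : ℝ) - 3) • lieDeriv (dilation _) (oneForm α)
              + (2 : ℝ) • extDeriv (interiorProd (dilation _) (oneForm α)))
          + (2 : ℝ) • lieDeriv (fun _ => F) (lieDeriv (dilation _) (oneForm α))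
          + ((m : ℝ) - 4) • lieDeriv (fun _ => F) (oneForm α)
          + (2 : ℝ) • extDeriv (interiorProd (fun _ => F) (oneForm α))) x := by
  ext v
  have h1 := h.pullback_laplaceDeRham_apply hm hx hα v
  rw [sub_eq_add_neg, normal_terms_eq m c _ hα] at h1
  rw [h1, ContinuousAlternatingMap.add_apply]
  refine congrArg _ ?_
  rw [pullback, ContinuousAlternatingMap.compContinuousLinearMap_apply]
  refine congrArg _ (funext fun i => ?_)
  rw [Subsingleton.elim (α := Fin 1) i 0]
  rfl

/-! ### Local parametrisations of `Σ_n` -/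

theorem minkowski_transpose (n : ℕ) : (minkowski n)ᵀ = minkowski n :=
  Matrix.diagonal_transpose _

theorem minkowski_det_ne (n : ℕ) : (minkowski n).det ≠ 0 := by
  rw [minkowski, Matrix.det_diagonal]
  refine Finset.prod_ne_zero_iff.mpr fun i _ => ?_
  split_ifs <;> norm_num

theorem gramForm_sharp {η : Matrix (Fin d) (Fin d) ℝ} (hs : ηᵀ = η) (hd : η.det ≠ 0)
    (f : (Fin d → ℝ) →L[ℝ] ℝ) (v : Fin d → ℝ) : gramForm η (sharp η f) v = f v := by
  rw [gramForm_comm hs, gramForm_apply, sharp, Matrix.mulVec_mulVec,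
    Matrix.mul_nonsing_inv _ hd.isUnit, Matrix.one_mulVec, ← sum_smul_apply_single f v]
  rfl

/-- The orthogonal complement of two vectors of `ℝ^(n + 2)` has dimension at least `n`. -/
theorem exists_injective_orthogonal (n : ℕ) (y z : Fin (n + 2) → ℝ)
    (η : Matrix (Fin (n + 2)) (Fin (n + 2)) ℝ) :
    ∃ L : (Fin n → ℝ) →L[ℝ] (Fin (n + 2) → ℝ), Function.Injective L ∧
      ∀ u, gramForm η y (L u) = 0 ∧ gramForm η z (L u) = 0 := by
  let A : (Fin (n + 2) → ℝ) →ₗ[ℝ] ℝ × ℝ :=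
    (gramForm η y).toLinearMap.prod (gramForm η z).toLinearMap
  have h1 := A.finrank_range_add_finrank_ker
  have h2 : Module.finrank ℝ A.range ≤ 2 := by
    simpa using A.range.finrank_le
  have h3 : n ≤ Module.finrank ℝ A.ker := by
    simp only [Module.finrank_fin_fun] at h1 ⊢
    omega
  obtain ⟨b, hb⟩ := exists_linearIndependent_of_le_finrank h3
  refine ⟨(A.ker.subtype ∘ₗ Fintype.linearCombination ℝ b).toContinuousLinearMap,
    (Submodule.injective_subtype _).comp hb.fintypeLinearCombination_injective, fun u => ?_⟩
  have := (Fintype.linearCombination ℝ b u).2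
  rw [LinearMap.mem_ker] at this
  exact ⟨congrArg Prod.fst this, congrArg Prod.snd this⟩

/-- Stereographic projection from `y`: with `F - (c / 2) y` the null vector dual to `y` in the plane
spanned by `y` and `F`, and `w` in the orthogonal complement of this plane, the vector
`y + w - (η(w, w) / 2) (F - (c / 2) y)` is null, and dividing it by its value under `f` puts it on
the hyperplane. -/
theorem exists_isLocalParam (n : ℕ) {f : (Fin (n + 2) → ℝ) →L[ℝ] ℝ} {y : Fin (n + 2) → ℝ}
    (hy : y ∈ adsSpace n f) : ∃ (U : Set (Fin n → ℝ)) (φ : (Fin n → ℝ) → (Fin (n + 2) → ℝ)),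
      IsLocalParam (adsSpace n f) U φ ∧ y ∈ φ '' U := by
  set F := sharp (minkowski n) f with hF
  set η := minkowski n with hη
  have hf : ∀ v, gramForm η F v = f v :=
    gramForm_sharp (minkowski_transpose n) (minkowski_det_ne n) f
  have hcomm : ∀ u v, gramForm η u v = gramForm η v u := gramForm_comm (minkowski_transpose n)
  set c := gramForm η F F with hc
  obtain ⟨L, hL, hLo⟩ := exists_injective_orthogonal n y F η
  have hyy : gramForm η y y = 0 := by rw [gramForm_apply]; exact hy.1
  have hFy : gramForm η F y = 1 := by rw [hf]; exact hy.2
  let q : (Fin n → ℝ) → ℝ := fun u => gramForm η (L u) (L u)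
  let N : (Fin n → ℝ) → ℝ := fun u => 1 - c / 4 * q u
  let φ : (Fin n → ℝ) → (Fin (n + 2) → ℝ) :=
    fun u => (N u)⁻¹ • (y + L u - (q u / 2) • (F - (c / 2) • y))
  have hq : ContDiff ℝ ∞ q := ((gramForm η).contDiff.comp L.contDiff).clm_apply L.contDiff
  have hN : ContDiff ℝ ∞ N := contDiff_const.sub (contDiff_const.mul hq)
  have hV : IsOpen {u | N u ≠ 0} := isOpen_ne_fun hN.continuous continuous_const
  have hφ : ContDiffOn ℝ ∞ φ {u | N u ≠ 0} :=
    (hN.contDiffOn.inv fun u hu => hu).smul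
      (((contDiff_const.add L.contDiff).sub ((hq.div_const 2).smul contDiff_const)).contDiffOn)
  have h0 : N 0 ≠ 0 := by simp [N, q]
  have hderiv : ∀ v, fderiv ℝ φ 0 v = L v := by
    intro v
    have hq' : HasFDerivAt q (0 : (Fin n → ℝ) →L[ℝ] ℝ) 0 := by
      have := (gramForm η).hasFDerivAt_of_bilinear (L.hasFDerivAt (x := 0)) (L.hasFDerivAt (x := 0))
      refine this.congr_fderiv ?_
      ext v
      simp
    have hN' : HasFDerivAt N (0 : (Fin n → ℝ) →L[ℝ] ℝ) 0 := by
      simpa using (hq'.const_mul (c / 4)).const_sub 1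
    have h1 : HasFDerivAt (fun u => y + L u - (q u / 2) • (F - (c / 2) • y)) L 0 := by
      have := ((L.hasFDerivAt (x := 0)).const_add y).sub
        ((hq'.mul_const (2⁻¹)).smul_const (F - (c / 2) • y))
      simpa [div_eq_mul_inv] using this
    have h2 : HasFDerivAt φ _ 0 := ((hasDerivAt_inv h0).comp_hasFDerivAt 0 hN').smul h1
    rw [h2.fderiv]
    simp [N, q]
  -- `U` is cut down to the points where `φ` is immersive, an open condition satisfied at `0`
  refine ⟨{u | N u ≠ 0} ∩ fderiv ℝ φ ⁻¹' {A | Function.Injective A}, φ,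
    ⟨(hφ.continuousOn_fderiv_of_isOpen hV (by simp)).isOpen_inter_preimage hV
      ContinuousLinearMap.isOpen_injective, hφ.mono Set.inter_subset_left, fun u hu => ?_,
      fun u hu => hu.2⟩, 0, ⟨h0, ?_⟩, by simp [φ, N, q]⟩
  · have hNu : N u ≠ 0 := hu.1
    obtain ⟨h1, h2⟩ := hLo u
    have h3 := hcomm (L u) y
    have h4 := hcomm (L u) F
    have h5 := hcomm y F
    constructor
    · rw [← hη, ← gramForm_apply]
      simp only [φ, map_smul, map_add, map_sub, smul_apply, add_apply, sub_apply, smul_eq_mul,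
        h3, h4, h5, h1, h2, hyy, hFy, ← hc]
      rw [show gramForm η (L u) (L u) = q u from rfl]
      ring
    · rw [← hf]
      simp only [φ, map_smul, map_add, map_sub, smul_eq_mul, h2, hFy, ← hc]
      rw [inv_mul_eq_one₀ hNu]
      simp only [N]
      ring
  · show Function.Injective (fderiv ℝ φ 0)
    rw [show ⇑(fderiv ℝ φ 0) = ⇑L from funext hderiv]
    exact hL

theorem IsLocalParam.isConeSection {n : ℕ} {f : (Fin (n + 2) → ℝ) →L[ℝ] ℝ}
    {U : Set (Fin n → ℝ)} {φ : (Fin n → ℝ) → (Fin (n + 2) → ℝ)} {c : ℝ}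
    (h : IsLocalParam (adsSpace n f) U φ)
    (hc : gramForm (minkowski n) (sharp (minkowski n) f) (sharp (minkowski n) f) = c) :
    IsConeSection (minkowski n) (sharp (minkowski n) f) c U φ where
  transpose_eq := minkowski_transpose n
  det_ne := minkowski_det_ne n
  sq := hc
  isOpen := h.isOpen
  smooth := h.smooth
  null x hx := (gramForm_apply _ _ _).trans (h.mapsTo hx).1
  height x hx := by
    rw [gramForm_sharp (minkowski_transpose n) (minkowski_det_ne n)]
    exact (h.mapsTo hx).2
  immersion := h.immersion

end Restriction

end HodgeDeRham

theorem mainTheorem1 (n : ℕ) (hn : 1 ≤ n) (f : (Fin (n + 2) → ℝ) →L[ℝ] ℝ)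
    (F : (Fin (n + 2) → ℝ) → (Fin (n + 2) → ℝ))
    (hF : ∀ y, F y = sharp (minkowski n) (fderiv ℝ f y))
    (ε H : ℝ) (hε : ε = 1 ∨ ε = -1) (hH : 0 < H)
    (hF2 : ∀ y, F y ⬝ᵥ (minkowski n).mulVec (F y) = ε * H ^ 2) :
    -- the local parametrisations cover `Σ_n`
    (∀ y ∈ adsSpace n f, ∃ (U : Set (Fin n → ℝ)) (φ : (Fin n → ℝ) → (Fin (n + 2) → ℝ)),
      IsLocalParam (adsSpace n f) U φ ∧ y ∈ φ '' U) ∧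
    -- the commutator of `F` and `D`
    VectorField.lieBracket ℝ F (dilation (n + 2)) = F ∧
    -- both forms of the restriction formula, in every local parametrisation
    ∀ a : DForm (n + 2) 1, ContDiff ℝ ∞ a →
      ∀ (U : Set (Fin n → ℝ)) (φ : (Fin n → ℝ) → (Fin (n + 2) → ℝ)),
        IsLocalParam (adsSpace n f) U φ → ∀ x ∈ U,
          pullback φ (laplaceDeRham (fun _ => minkowski n) a) x =
              laplaceDeRham (inducedMetric (minkowski n) φ) (pullback φ a) x +
              pullback φ
                (-(ε * H ^ 2) • (lieDeriv (dilation _) (lieDeriv (dilation _) a)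
                      + ((n : ℝ) - 3) • lieDeriv (dilation _) a
                      + (2 : ℝ) • extDeriv (interiorProd (dilation _) a))
                  + (2 : ℝ) • lieDeriv F (lieDeriv (dilation _) a)
                  + ((n : ℝ) - 4) • lieDeriv F a
                  + (2 : ℝ) • extDeriv (interiorProd F a)) x ∧
          pullback φ (laplaceDeRham (fun _ => minkowski n) a) x =
              laplaceDeRham (inducedMetric (minkowski n) φ) (pullback φ a) x +
              pullback φ
                (-(ε * H ^ 2) • (lieDeriv (dilation _) (lieDeriv (dilation _) a)
                      + ((n : ℝ) - 3) • lieDeriv (dilation _) a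
                      + (2 : ℝ) • extDeriv (interiorProd (dilation _) a))
                  + (2 : ℝ) • lieDeriv (dilation _) (lieDeriv F a)
                  + ((n : ℝ) - 2) • lieDeriv F a
                  + (2 : ℝ) • extDeriv (interiorProd F a)) x := by
  obtain rfl : F = fun _ => sharp (minkowski n) f := funext fun y => by
    rw [hF, ContinuousLinearMap.fderiv]
  have hc : gramForm (minkowski n) (sharp (minkowski n) f) (sharp (minkowski n) f) = ε * H ^ 2 :=
    (gramForm_apply _ _ _).trans (hF2 0)
  refine ⟨fun y hy => exists_isLocalParam n hy, ?_, ?_⟩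
  · ext1 y
    simp [VectorField.lieBracket, (hasFDerivAt_dilation y).fderiv]
  · intro a ha U φ hφ x hx
    obtain ⟨α, hα, rfl⟩ := exists_oneForm_eq ha
    have key := (hφ.isConeSection hc).pullback_laplaceDeRham hn hx hα
    refine ⟨key, key.trans ?_⟩
    rw [lieDeriv_comm _ hα]
    congr 2
    module
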